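/- Let $\Sigma\subseteq A^{\mathbb Z}$ be a shift of finite type over a nonempty finite alphabet $A$, that is, the set of all bi-infinite sequences over $A$ that avoid some finite set of forbidden finite patterns. Sequence spaces carry the product topology of the discrete topology on the alphabet, and $\sigma$ denotes the shift, $(\sigma(x))_i=x_{i+1}$. A collection of prototiles is a nonempty finite set $\mathcal P=\{P_1,\dots,P_K\}$ of (distinct) nonempty finite subsets of $\mathbb Z$, each with minimum $0$. A tiling of the integers by $\mathcal P$ is an expression of $\mathbb Z$ as a disjoint union of translates of prototiles, $\mathbb Z=\bigcup_j (t_j+P_{k_j})$. The tiling system $T(\mathcal P)\subseteq\{1,\dots,K\}^{\mathbb Z}$ is the set of all sequences $x=(x_i)_{i\in\mathbb Z}$ for which there is such a tiling with, for all $i$ and $k$, $x_i=k$ if and only if there is a $j$ with $i\in t_j+P_{k_j}$ and $k_j=k$. Then there are an integer $m\ge 1$, a collection of prototiles $\mathcal P$ and sets $T_0,\dots,T_{m-1}$ such that, with $T=T(\mathcal P)$: 1. $T=T_0\cup T_1\cup\dots\cup T_{m-1}$, where the $T_i$ are closed and cyclically permuted by the shift: $\sigma(T_i)=T_{i+1}$,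 with indices taken modulo $m$; 2. for every $i$, $\sigma^m$ maps $T_i$ into itself, and $\sigma^m:\Sigma\to\Sigma$ is topologically conjugate to $\sigma^m:T_i\to T_i$, i.e. there is a homeomorphism $h:\Sigma\to T_i$ with $h\circ\sigma^m=\sigma^m\circ h$. -/

import Mathlib

open SymbolicDynamics.FullShift

/-- A subshift over `ℤ` is of finite type if it consists of the bi-infinite sequences that avoid
some finite set of forbidden patterns. -/
def IsOfFiniteType {A : Type*} [TopologicalSpace A] [Inhabited A] (X : Subshift A ℤ) : Prop :=
  ∃ F : Set (Pattern A ℤ), F.Finite ∧ X.carrier = forbidden F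

/-- Topological conjugacy of two self-maps. -/
def TopologicallyConjugate {X Y : Type*} [TopologicalSpace X] [TopologicalSpace Y]
    (f : X → X) (g : Y → Y) : Prop :=
  ∃ h : X ≃ₜ Y, Function.Semiconj h f g

/-- A finite collection of finite sets of integers is a collection of prototiles if it is nonempty
and each of its members is nonempty with minimum `0`. -/
def IsPrototileCollection (P : Finset (Finset ℤ)) : Prop :=
  P.Nonempty ∧ ∀ p ∈ P, IsLeast (p : Set ℤ) 0

/-- The colors are in one-to-one correspondence with the prototiles: there is one color for each
member of `P`. -/
def Color (P : Finset (Finset ℤ)) : Type := {p : Finset ℤ // p ∈ P}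

instance (P : Finset (Finset ℤ)) : TopologicalSpace (Color P) := ⊥

instance (P : Finset (Finset ℤ)) : DiscreteTopology (Color P) := ⟨rfl⟩

/-- The tile `t + p` given by a translation `t` and a prototile `p`. -/
def tile {P : Finset (Finset ℤ)} (q : ℤ × Color P) : Set ℤ :=
  (fun s => q.1 + s) '' (q.2.val : Set ℤ)

/-- A tiling of the integers by `P`: a set of tiles (each given by its translation and its
prototile) of which `ℤ` is the disjoint union. -/
def IsTiling {P : Finset (Finset ℤ)} (S : Set (ℤ × Color P)) : Prop :=
  S.PairwiseDisjoint tile ∧ ⋃ q ∈ S, tile q = Set.univ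

/-- The set `T(P)` of the bi-infinite color sequences of tilings of the integers by `P`: the
`i`-th entry is `k` if and only if `i` lies in a tile of the tiling with prototile `k`. -/
def tilingSpace (P : Finset (Finset ℤ)) : Set (ℤ → Color P) :=
  {x | ∃ S : Set (ℤ × Color P), IsTiling S ∧
    ∀ (i : ℤ) (k : Color P), x i = k ↔ ∃ q ∈ S, i ∈ tile q ∧ q.2 = k}

-- Cut ℤ into rows of B = 3z + 1 columns of three cells, and the rows into blocks of 2r. In a block,
-- tile i < r starts at row i and takes most of it; in every column it also takes one entry of the
-- last r rows, the common region, chosen by a permutation of `Fin r`. A block has up to (r!)^B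
-- fillings, while its length m = 6Br is linear in r. Since r! outgrows every exponential, the
-- fillings outnumber the words of length m + n over A, n being a window length that defines Σ.
-- These words label the edges of a finite graph whose path shift is σ^m on Σ, so edges can be
-- written as permutations.
--
-- The number of edges between two vertices need not be a power of r!. Its base-r! expansion
-- (`exists_partition_pow`) splits them into classes of (r!)^q edges, each matched with the
-- sequences of q free permutations. Class and phase are cut into the row of the tile as one-cell
-- holes, which the tabs of the preceding tile fill. At the end of a block, tabs may announce only a
-- class whose source is the current target.
--
-- Conversely, only tabs fit the holes, and as all codes contain the extreme columns z and 2z, they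
-- fit only when aligned (`exists_tile_of_mem_code`, `exists_pred`). So every tile has a
-- predecessor, all blocks lie on one progression of step m (`HasTile.exists_eq_add`), and every
-- tiling is a translate of that of a path (`exists_path_of_isTiling`). The tiling system is thus
-- the union of m translates of a compact copy of Σ. An empty Σ is matched by a prototile that does
-- not tile.

universe u

/-! ### Coordinates on the integers -/

/-- The integer with row `R`, column `b` and residue `ρ`, for rows of `B` columns of three cells. -/
def cell (B : ℕ) (R : ℤ) (b ρ : ℕ) : ℤ := 3 * (B * R + b) + ρ

theorem eq_of_mul_add_eq {n : ℕ} {k k' : ℤ} {w w' : ℕ} (hw : w < n) (hw' : w' < n)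
    (h : (n : ℤ) * k + w = n * k' + w') : k = k' ∧ w = w' := by
  have hn : (0 : ℤ) < n := by omega
  have h1 : ((n : ℤ) * k + w) / n = k := by
    rw [Int.add_comm, Int.add_mul_ediv_left _ _ hn.ne', Int.ediv_eq_zero_of_lt (by omega)
      (by omega), zero_add]
  have h2 : ((n : ℤ) * k' + w') / n = k' := by
    rw [Int.add_comm, Int.add_mul_ediv_left _ _ hn.ne', Int.ediv_eq_zero_of_lt (by omega)
      (by omega), zero_add]
  have hk : k = k' := by rw [← h1, ← h2, h]
  subst hk
  exact ⟨rfl, by omega⟩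

theorem exists_eq_mul_add {n : ℕ} (hn : 0 < n) (x : ℤ) :
    ∃ (k : ℤ) (w : ℕ), w < n ∧ x = n * k + w := by
  refine ⟨x / n, (x % n).toNat, ?_, ?_⟩
  · have := Int.emod_lt_of_pos x (show (0 : ℤ) < n by omega)
    omega
  · have := Int.emod_nonneg x (show (n : ℤ) ≠ 0 by omega)
    have h2 := Int.mul_ediv_add_emod x n
    omega

theorem cell_inj {B : ℕ} {R R' : ℤ} {b b' ρ ρ' : ℕ} (hb : b < B) (hb' : b' < B) (hρ : ρ < 3)
    (hρ' : ρ' < 3) (h : cell B R b ρ = cell B R' b' ρ') : R = R' ∧ b = b' ∧ ρ = ρ' := by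
  obtain ⟨h1, h2⟩ := eq_of_mul_add_eq (n := 3) hρ hρ' h
  obtain ⟨h3, h4⟩ := eq_of_mul_add_eq hb hb' h1
  exact ⟨h3, h4, h2⟩

theorem exists_eq_cell {B : ℕ} (hB : 0 < B) (x : ℤ) :
    ∃ (R : ℤ) (b ρ : ℕ), b < B ∧ ρ < 3 ∧ x = cell B R b ρ := by
  obtain ⟨y, ρ, hρ, rfl⟩ := exists_eq_mul_add (n := 3) (by norm_num) x
  obtain ⟨R, b, hb, rfl⟩ := exists_eq_mul_add hB y
  exact ⟨R, b, ρ, hb, hρ, rfl⟩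

theorem cell_add_cell (B : ℕ) (R R' : ℤ) (b ρ : ℕ) :
    cell B R 0 0 + cell B R' b ρ = cell B (R + R') b ρ := by
  simp only [cell]; push_cast; ring

/-! ### Codings of the edges of a finite graph -/

/-- A partition of the edges `E` of a finite directed graph into classes `Ω` with common source and
target, an identification of the class of `ω` with the sequences of `free ω` permutations of
`Fin r`, and a code of the pairs of a phase and a class by finite sets of columns. -/
structure TileCoding {E V : Type*} (src tgt : E → V) (Ω : Type*) where
  r : ℕ
  z : ℕ
  r_pos : 0 < r
  z_pos : 0 < z
  mark : E → Ω
  source : Ω → V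
  target : Ω → V
  source_mark : ∀ e, source (mark e) = src e
  target_mark : ∀ e, target (mark e) = tgt e
  free : Ω → ℕ
  free_le : ∀ ω, free ω ≤ 3 * z + 1
  perm : E → ℕ → Equiv.Perm (Fin r)
  perm_eq_one : ∀ e b, free (mark e) ≤ b → perm e b = 1
  eq_of_perm_eq : ∀ e e', mark e = mark e' → perm e = perm e' → e = e'
  exists_perm_eq : ∀ ω (π : ℕ → Equiv.Perm (Fin r)), (∀ b, free ω ≤ b → π b = 1) →
    ∃ e, mark e = ω ∧ perm e = π
  code : ℕ → Ω → Finset ℕ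
  code_subset : ∀ i ω, code i ω ⊆ Finset.Icc z (2 * z)
  left_mem_code : ∀ i ω, z ∈ code i ω
  right_mem_code : ∀ i ω, 2 * z ∈ code i ω
  code_inj : ∀ i < r, ∀ i' < r, ∀ ω₁ ω₂, code i ω₁ = code i' ω₂ → i = i' ∧ ω₁ = ω₂

/-- The data of a tile: its phase, its class, the class announced to the next tile, and the row
that it occupies in each column of the common region. -/
structure TileParam (Ω : Type*) where
  phase : ℕ
  inMark : Ω
  outMark : Ω
  col : ℕ → ℕ

/-! ### Prototiles with holes, bodies and tabs -/

namespace TileCoding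

variable {E V Ω : Type*} {src tgt : E → V} (C : TileCoding src tgt Ω)

/-- The number of columns. -/
def width : ℕ := 3 * C.z + 1

/-- The number of integers in a block. -/
def period : ℕ := 6 * C.width * C.r

theorem width_pos : 0 < C.width := by simp [width]

theorem period_pos : 0 < C.period := by
  have := C.r_pos
  have := C.width_pos
  unfold period; positivity

theorem period_eq_cell : (C.period : ℤ) = cell C.width (2 * C.r) 0 0 := by
  simp only [period, cell]; push_cast; ring

/-- The phase that follows `i`. -/
def nextPhase (i : ℕ) : ℕ := if i + 1 < C.r then i + 1 else 0

/-- The number of rows from a tile of phase `i` to the next one. -/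
def gap (i : ℕ) : ℤ := if i + 1 < C.r then 1 else C.r + 1

/-- The position with row `R`, column `b` and residue `ρ` belongs to the tile with data `τ`. -/
def Occupies (τ : TileParam Ω) (R : ℤ) (b ρ : ℕ) : Prop :=
  (R = 0 ∧ ¬ (ρ = 0 ∧ b ∈ C.code τ.phase τ.inMark)) ∨ R + τ.phase = C.r + τ.col b ∨
    (R = C.gap τ.phase ∧ ρ = 0 ∧ b ∈ C.code (C.nextPhase τ.phase) τ.outMark)

/-- The data of a tile are admissible. -/
structure Valid (τ : TileParam Ω) : Prop where
  phase_lt : τ.phase < C.r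
  col_lt : ∀ b < C.width, τ.col b < C.r
  col_eq : ∀ b < C.width, C.free τ.inMark ≤ b → τ.col b = τ.phase
  out_eq : τ.phase + 1 < C.r → τ.outMark = τ.inMark
  link : τ.phase + 1 = C.r → C.target τ.inMark = C.source τ.outMark

open Classical in
/-- The prototile with data `τ`. -/
noncomputable def shape (τ : TileParam Ω) : Finset ℤ :=
  (Finset.Ico 0 (cell C.width (2 * C.r + 2) 0 0)).filter fun x =>
    ∃ (R : ℤ) (b ρ : ℕ), b < C.width ∧ ρ < 3 ∧ x = cell C.width R b ρ ∧ C.Occupies τ R b ρ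

variable {C}

theorem mem_width_of_mem_code {i b : ℕ} {ω : Ω} (h : b ∈ C.code i ω) :
    C.z ≤ b ∧ b ≤ 2 * C.z ∧ b < C.width := by
  have := Finset.mem_Icc.1 (C.code_subset i ω h)
  have := C.z_pos
  simp only [width]; omega

theorem gap_cases (i : ℕ) (hi : i < C.r) :
    (i + 1 < C.r ∧ C.gap i = 1 ∧ C.nextPhase i = i + 1) ∨
      (i + 1 = C.r ∧ C.gap i = C.r + 1 ∧ C.nextPhase i = 0) := by
  unfold gap nextPhase
  split_ifs with h
  · exact Or.inl ⟨h, rfl, rfl⟩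
  · exact Or.inr ⟨by omega, rfl, rfl⟩

theorem nextPhase_lt (i : ℕ) : C.nextPhase i < C.r := by
  have := C.r_pos
  unfold nextPhase; split_ifs <;> omega

theorem Valid.row_bounds {τ : TileParam Ω} (h : C.Valid τ) {R : ℤ} {b ρ : ℕ} (hb : b < C.width)
    (hR : C.Occupies τ R b ρ) : 0 ≤ R ∧ R < 2 * C.r + 1 := by
  have h1 := h.phase_lt
  have h2 := h.col_lt b hb
  rcases hR with ⟨rfl, -⟩ | hR | ⟨rfl, -⟩
  · omega
  · omega
  · rcases gap_cases τ.phase h1 with ⟨-, h, -⟩ | ⟨-, h, -⟩ <;> omega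

theorem Valid.mem_shape {τ : TileParam Ω} (h : C.Valid τ) {x : ℤ} :
    x ∈ C.shape τ ↔ ∃ (R : ℤ) (b ρ : ℕ), b < C.width ∧ ρ < 3 ∧ x = cell C.width R b ρ ∧
      C.Occupies τ R b ρ := by
  simp only [shape, Finset.mem_filter, Finset.mem_Ico, and_iff_right_iff_imp]
  rintro ⟨R, b, ρ, hb, hρ, rfl, hR⟩
  obtain ⟨h1, h2⟩ := h.row_bounds hb hR
  unfold cell
  constructor
  · positivity
  · push_cast
    have : (C.width : ℤ) * R + C.width ≤ C.width * (2 * C.r + 2) := by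
      nlinarith
    omega

theorem Valid.cell_mem_shape {τ : TileParam Ω} (h : C.Valid τ) {R : ℤ} {b ρ : ℕ}
    (hb : b < C.width) (hρ : ρ < 3) :
    cell C.width R b ρ ∈ C.shape τ ↔ C.Occupies τ R b ρ := by
  rw [h.mem_shape]
  constructor
  · rintro ⟨R', b', ρ', hb', hρ', he, hR⟩
    obtain ⟨rfl, rfl, rfl⟩ := cell_inj hb hb' hρ hρ' he
    exact hR
  · exact fun hR => ⟨R, b, ρ, hb, hρ, rfl, hR⟩

theorem occupies_zero_zero (τ : TileParam Ω) : C.Occupies τ 0 0 0 := by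
  refine Or.inl ⟨rfl, fun h => ?_⟩
  have := mem_width_of_mem_code h.2
  have := C.z_pos
  omega

theorem Valid.isLeast_shape {τ : TileParam Ω} (h : C.Valid τ) :
    IsLeast (C.shape τ : Set ℤ) 0 := by
  constructor
  · have := (h.cell_mem_shape C.width_pos (by norm_num)).2 (occupies_zero_zero τ)
    simpa [cell] using this
  · intro x hx
    obtain ⟨R, b, ρ, hb, hρ, rfl, hR⟩ := h.mem_shape.1 hx
    have := (h.row_bounds hb hR).1
    unfold cell; positivity

theorem Valid.occupies_zero_iff {τ : TileParam Ω} (h : C.Valid τ) {b : ℕ} (hb : b < C.width) :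
    C.Occupies τ 0 b 0 ↔ b ∉ C.code τ.phase τ.inMark := by
  have h1 := h.phase_lt
  have h2 := h.col_lt b hb
  constructor
  · rintro (⟨-, h⟩ | h | ⟨h, -⟩) hc
    · exact h ⟨rfl, hc⟩
    · omega
    · rcases gap_cases τ.phase h1 with ⟨-, h, -⟩ | ⟨-, h, -⟩ <;> omega
  · exact fun h => Or.inl ⟨rfl, fun h' => h h'.2⟩

theorem Valid.occupies_gap_iff {τ : TileParam Ω} (h : C.Valid τ) {b : ℕ} (hb : b < C.width) :
    C.Occupies τ (C.gap τ.phase) b 0 ↔ b ∈ C.code (C.nextPhase τ.phase) τ.outMark := by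
  have h1 := h.phase_lt
  have h2 := h.col_lt b hb
  constructor
  · rintro (⟨h, -⟩ | h | ⟨-, -, h⟩)
    · rcases gap_cases τ.phase h1 with ⟨-, h', -⟩ | ⟨-, h', -⟩ <;> omega
    · rcases gap_cases τ.phase h1 with ⟨h3, h', -⟩ | ⟨h3, h', -⟩ <;> omega
    · exact h
  · exact fun h => Or.inr (Or.inr ⟨rfl, rfl, h⟩)

/-- The shape of a tile determines its data. -/
theorem Valid.eq_of_shape_eq {τ τ' : TileParam Ω} (h : C.Valid τ) (h' : C.Valid τ')
    (he : C.shape τ = C.shape τ') :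
    τ.phase = τ'.phase ∧ τ.inMark = τ'.inMark ∧ ∀ b < C.width, τ.col b = τ'.col b := by
  have key : ∀ R b ρ, b < C.width → ρ < 3 → (C.Occupies τ R b ρ ↔ C.Occupies τ' R b ρ) := by
    intro R b ρ hb hρ
    rw [← h.cell_mem_shape hb hρ, ← h'.cell_mem_shape hb hρ, he]
  obtain ⟨h1, h2⟩ : τ.phase = τ'.phase ∧ τ.inMark = τ'.inMark := by
    apply C.code_inj _ h.phase_lt _ h'.phase_lt
    ext b
    by_cases hb : b < C.width
    · have := key 0 b 0 hb (by norm_num)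
      rw [h.occupies_zero_iff hb, h'.occupies_zero_iff hb] at this
      tauto
    · exact ⟨fun hc => absurd (mem_width_of_mem_code hc).2.2 hb,
        fun hc => absurd (mem_width_of_mem_code hc).2.2 hb⟩
  refine ⟨h1, h2, fun b hb => ?_⟩
  -- Residue 1 avoids the tabs, and this row is positive, so the cell can only come from the common
  -- region.
  have := (key (C.r + τ.col b - τ.phase) b 1 hb (by norm_num)).1 (Or.inr (Or.inl (by ring)))
  have h3 := h.phase_lt
  rcases this with ⟨h, -⟩ | h | ⟨-, h, -⟩ <;> omega

/-! ### The tiling of a path -/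

/-- Consecutive families of tiles cover the block in which they are complete. -/
theorem exists_occupies (f : ℤ → ℕ → TileParam Ω) (k : ℤ) (ω : Ω)
    (hf : ∀ i < C.r, (f k i).phase = i ∧ (f k i).inMark = ω ∧ (i + 1 < C.r → (f k i).outMark = ω))
    (hprev : (f (k - 1) (C.r - 1)).phase = C.r - 1 ∧ (f (k - 1) (C.r - 1)).outMark = ω)
    (hcol : ∀ b < C.width, ∀ j < C.r, ∃ i < C.r, (f k i).col b = j)
    {w b ρ : ℕ} (hw : w < 2 * C.r) (hb : b < C.width) :
    ∃ k' i, (k' = k ∨ k' = k - 1 ∧ i = C.r - 1) ∧ i < C.r ∧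
      C.Occupies (f k' i) (2 * C.r * k + w - (2 * C.r * k' + i)) b ρ := by
  have hr := C.r_pos
  by_cases hwr : C.r ≤ w
  · obtain ⟨i, hi, hj⟩ := hcol b hb (w - C.r) (by omega)
    refine ⟨k, i, Or.inl rfl, hi, Or.inr (Or.inl ?_)⟩
    rw [(hf i hi).1, hj]
    omega
  push Not at hwr
  by_cases hh : ρ = 0 ∧ b ∈ C.code w ω
  · by_cases h0 : w = 0
    · subst h0
      refine ⟨k - 1, C.r - 1, Or.inr ⟨rfl, rfl⟩, by omega, Or.inr (Or.inr ⟨?_, hh.1, ?_⟩)⟩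
      · rw [hprev.1]
        rcases gap_cases (C := C) (C.r - 1) (by omega) with ⟨h, -, -⟩ | ⟨h, h', -⟩
        · omega
        · rw [h', Nat.cast_sub (by omega)]; push_cast; ring
      · rw [hprev.1, hprev.2]
        rcases gap_cases (C := C) (C.r - 1) (by omega) with ⟨h, -, -⟩ | ⟨h, -, h'⟩
        · omega
        · rw [h']; exact hh.2
    · obtain ⟨i, rfl⟩ : ∃ i, w = i + 1 := ⟨w - 1, by omega⟩
      have hi := hf i (by omega)
      refine ⟨k, i, Or.inl rfl, by omega, Or.inr (Or.inr ⟨?_, hh.1, ?_⟩)⟩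
      · rw [hi.1]
        rcases gap_cases (C := C) i (by omega) with ⟨h, h', -⟩ | ⟨h, h', -⟩
        · rw [h']; push_cast; ring
        · omega
      · rw [hi.1, hi.2.2 (by omega)]
        rcases gap_cases (C := C) i (by omega) with ⟨h, -, h'⟩ | ⟨h, -, h'⟩
        · rw [h']; exact hh.2
        · omega
  · refine ⟨k, w, Or.inl rfl, hwr, Or.inl ⟨by ring, ?_⟩⟩
    rw [(hf w hwr).1, (hf w hwr).2.1]
    exact hh

variable (C)

open Classical in
/-- The collection of all admissible prototiles. -/
noncomputable def prototiles : Finset (Finset ℤ) :=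
  (Finset.Ico 0 (cell C.width (2 * C.r + 2) 0 0)).powerset.filter fun p =>
    ∃ τ, C.Valid τ ∧ p = C.shape τ

variable {C}

open Classical in
theorem mem_prototiles {p : Finset ℤ} : p ∈ C.prototiles ↔ ∃ τ, C.Valid τ ∧ p = C.shape τ := by
  simp only [prototiles, Finset.mem_filter, Finset.mem_powerset, and_iff_right_iff_imp]
  rintro ⟨τ, -, rfl⟩
  exact Finset.filter_subset _ _

theorem Valid.shape_mem {τ : TileParam Ω} (h : C.Valid τ) : C.shape τ ∈ C.prototiles :=
  mem_prototiles.2 ⟨τ, h, rfl⟩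

variable (C)

/-- The data of the tile of phase `i` in the block `k` of the path `e`. -/
def param (e : ℤ → E) (k : ℤ) (i : Fin C.r) : TileParam Ω where
  phase := i
  inMark := C.mark (e k)
  outMark := if (i : ℕ) + 1 < C.r then C.mark (e k) else C.mark (e (k + 1))
  col b := C.perm (e k) b i

/-- `e` is a bi-infinite path. -/
def _root_.IsPath (src tgt : E → V) (e : ℤ → E) : Prop := ∀ k, tgt (e k) = src (e (k + 1))

variable {C}

theorem valid_param {e : ℤ → E} (he : IsPath src tgt e) (k : ℤ) (i : Fin C.r) :
    C.Valid (C.param e k i) where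
  phase_lt := i.2
  col_lt b _ := (C.perm (e k) b i).2
  col_eq b _ h := by simp [param, C.perm_eq_one _ _ h]
  out_eq h := if_pos h
  link h := by
    have h : (i : ℕ) + 1 = C.r := h
    simp [param, h, C.target_mark, C.source_mark, he k]

/-- Division by 2r recovers the owner of a cell from its role: body of a starting row, common
region, or hole filled by a tab. The roles exclude one another, which gives uniqueness of the owner.
-/
theorem param_occupies {e : ℤ → E} {k k' : ℤ} {w b ρ : ℕ} {i : Fin C.r} (hw : w < 2 * C.r)
    (h : C.Occupies (C.param e k' i) (2 * C.r * k + w - (2 * C.r * k' + i)) b ρ) :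
    (k' = k ∧ w = i ∧ ¬ (ρ = 0 ∧ b ∈ C.code w (C.mark (e k)))) ∨
      (k' = k ∧ w = C.r + C.perm (e k) b i) ∨
      (w < C.r ∧ (ρ = 0 ∧ b ∈ C.code w (C.mark (e k))) ∧
        ((w = i + 1 ∧ k' = k) ∨ (w = 0 ∧ (i : ℕ) + 1 = C.r ∧ k' = k - 1))) := by
  have hi := i.2
  have hr := C.r_pos
  rcases h with ⟨h1, h2⟩ | h1 | ⟨h1, h2, h3⟩
  · obtain ⟨rfl, rfl⟩ := eq_of_mul_add_eq (n := 2 * C.r) (k := k) (k' := k') (w := w) (w' := i)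
      hw (by omega) (by push_cast; linarith)
    exact Or.inl ⟨rfl, rfl, h2⟩
  · have hp := (C.perm (e k') b i).2
    obtain ⟨rfl, rfl⟩ := eq_of_mul_add_eq (n := 2 * C.r) (k := k) (k' := k') (w := w)
      (w' := C.r + C.perm (e k') b i) hw (by omega)
      (by simp only [param] at h1; push_cast; linarith)
    exact Or.inr (Or.inl ⟨rfl, rfl⟩)
  · have hph : (C.param e k' i).phase = i := rfl
    rw [hph] at h1 h3
    rcases gap_cases (C := C) i hi with ⟨h, h', h4⟩ | ⟨h, h', h4⟩
    · rw [h'] at h1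
      obtain ⟨rfl, rfl⟩ := eq_of_mul_add_eq (n := 2 * C.r) (k := k) (k' := k') (w := w)
        (w' := i + 1) hw (by omega) (by push_cast; linarith)
      refine Or.inr (Or.inr ⟨h, ⟨h2, ?_⟩, Or.inl ⟨rfl, rfl⟩⟩)
      simpa [param, h4, h] using h3
    · rw [h'] at h1
      have hc : (i : ℤ) + 1 = C.r := by exact_mod_cast h
      obtain ⟨rfl, rfl⟩ := eq_of_mul_add_eq (n := 2 * C.r) (k := k) (k' := k' + 1) (w := w)
        (w' := 0) hw (by omega) (by push_cast; linarith)
      refine Or.inr (Or.inr ⟨hr, ⟨h2, ?_⟩, Or.inr ⟨rfl, h, by ring⟩⟩)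
      simpa [param, h4, h] using h3

/-- Every position belongs to exactly one tile of a path. -/
theorem existsUnique_occupies (e : ℤ → E) (R : ℤ) {b ρ : ℕ} (hb : b < C.width) :
    ∃! p : ℤ × Fin C.r, C.Occupies (C.param e p.1 p.2) (R - (2 * C.r * p.1 + p.2)) b ρ := by
  have hr := C.r_pos
  obtain ⟨k, w, hw, rfl⟩ := exists_eq_mul_add (n := 2 * C.r) (by omega) R
  let f : ℤ → ℕ → TileParam Ω := fun k i =>
    if h : i < C.r then C.param e k ⟨i, h⟩ else C.param e k ⟨0, hr⟩
  have hfi : ∀ k i (h : i < C.r), f k i = C.param e k ⟨i, h⟩ := fun k i h => dif_pos h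
  obtain ⟨k', i, -, hi, ho⟩ := exists_occupies (C := C) (ρ := ρ) f k (C.mark (e k))
    (fun i hi => by
      rw [hfi _ _ hi]
      exact ⟨rfl, rfl, fun h => if_pos h⟩)
    (by
      rw [hfi _ _ (by omega)]
      refine ⟨rfl, ?_⟩
      simp [param, Nat.sub_add_cancel hr])
    (fun b _ j hj => ⟨(C.perm (e k) b).symm ⟨j, hj⟩, Fin.is_lt _, by
      rw [hfi _ _ (Fin.is_lt _)]; simp [param]⟩) hw hb
  rw [hfi _ _ hi] at ho
  obtain ⟨i, rfl⟩ : ∃ i' : Fin C.r, (i' : ℕ) = i := ⟨⟨i, hi⟩, rfl⟩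
  replace ho : C.Occupies (C.param e k' i) (2 * C.r * k + w - (2 * C.r * k' + i)) b ρ := ho
  refine ⟨⟨k', i⟩, by push_cast; exact ho, ?_⟩
  rintro ⟨k₂, i₂⟩ ho₂
  have ho₂ : C.Occupies (C.param e k₂ i₂) (2 * C.r * k + w - (2 * C.r * k₂ + i₂)) b ρ := by
    push_cast at ho₂; exact ho₂
  have h1 := param_occupies hw ho
  have h2 := param_occupies hw ho₂
  have hi₂ := i₂.2
  rw [Prod.mk.injEq, Fin.ext_iff]
  rcases h1 with ⟨a1, a2, a3⟩ | ⟨a1, a2⟩ | ⟨a1, a2, a3⟩ <;>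
    rcases h2 with ⟨c1, c2, c3⟩ | ⟨c1, c2⟩ | ⟨c1, c2, c3⟩
  · exact ⟨c1.trans a1.symm, c2.symm.trans a2⟩
  · omega
  · exact absurd c2 a3
  · omega
  -- In the common region the owner is unique because the permutation of the column is injective.
  · refine ⟨c1.trans a1.symm, congrArg Fin.val ?_⟩
    apply (C.perm (e k) b).injective
    apply Fin.ext
    omega
  · omega
  · exact absurd a2 c3
  · omega
  · omega

end TileCoding

theorem mem_tile {P : Finset (Finset ℤ)} {q : ℤ × Color P} {x : ℤ} :
    x ∈ tile q ↔ x - q.1 ∈ q.2.val := by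
  simp only [tile, Set.mem_image, Finset.mem_coe]
  constructor
  · rintro ⟨s, hs, rfl⟩; simpa using hs
  · exact fun h => ⟨_, h, by ring⟩

theorem IsTiling.exists_mem {P : Finset (Finset ℤ)} {S : Set (ℤ × Color P)} (hS : IsTiling S)
    (x : ℤ) : ∃ q ∈ S, x ∈ tile q := by
  have : x ∈ ⋃ q ∈ S, tile q := hS.2 ▸ Set.mem_univ x
  simpa using this

theorem IsTiling.eq_of_mem {P : Finset (Finset ℤ)} {S : Set (ℤ × Color P)} (hS : IsTiling S)
    {q q' : ℤ × Color P} (hq : q ∈ S) (hq' : q' ∈ S) {x : ℤ} (h : x ∈ tile q)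
    (h' : x ∈ tile q') : q = q' := by
  by_contra hne
  exact Set.disjoint_left.1 (hS.1 hq hq' hne) h h'

namespace TileCoding

variable {E V Ω : Type*} {src tgt : E → V} {C : TileCoding src tgt Ω}

theorem Valid.cell_mem_tile {τ : TileParam Ω} (h : C.Valid τ) {q : ℤ × Color C.prototiles}
    (hq : q.2.val = C.shape τ) {R : ℤ} {b ρ : ℕ} (hb : b < C.width) (hρ : ρ < 3) :
    q.1 + cell C.width R b ρ ∈ tile q ↔ C.Occupies τ R b ρ := by
  rw [mem_tile, add_sub_cancel_left, hq, h.cell_mem_shape hb hρ]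

variable (C) in
/-- The tiling given by a path. -/
def pathTiling (e : ℤ → E) : Set (ℤ × Color C.prototiles) :=
  {q | ∃ (k : ℤ) (i : Fin C.r), q.1 = cell C.width (2 * C.r * k + i) 0 0 ∧
    q.2.val = C.shape (C.param e k i)}

theorem isTiling_pathTiling {e : ℤ → E} (he : IsPath src tgt e) : IsTiling (C.pathTiling e) := by
  have key : ∀ (q : ℤ × Color C.prototiles) (k : ℤ) (i : Fin C.r),
      q.1 = cell C.width (2 * C.r * k + i) 0 0 → q.2.val = C.shape (C.param e k i) →
      ∀ R b ρ, b < C.width → ρ < 3 → (cell C.width R b ρ ∈ tile q ↔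
        C.Occupies (C.param e k i) (R - (2 * C.r * k + i)) b ρ) := by
    intro q k i h1 h2 R b ρ hb hρ
    rw [← (valid_param he k i).cell_mem_tile h2 hb hρ, h1, cell_add_cell, add_sub_cancel]
  constructor
  · rintro q ⟨k, i, h1, h2⟩ q' ⟨k', i', h1', h2'⟩ hne
    refine Set.disjoint_left.2 fun x hx hx' => hne ?_
    obtain ⟨R, b, ρ, hb, hρ, rfl⟩ := exists_eq_cell C.width_pos x
    rw [key q k i h1 h2 _ _ _ hb hρ] at hx
    rw [key q' k' i' h1' h2' _ _ _ hb hρ] at hx'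
    have := (existsUnique_occupies (C := C) e R (ρ := ρ) hb).unique (y₁ := (k, i))
      (y₂ := (k', i')) hx hx'
    obtain ⟨rfl, rfl⟩ := Prod.mk.inj this
    exact Prod.ext (h1.trans h1'.symm) (Subtype.ext (h2.trans h2'.symm))
  · refine Set.eq_univ_of_forall fun x => ?_
    obtain ⟨R, b, ρ, hb, hρ, rfl⟩ := exists_eq_cell C.width_pos x
    obtain ⟨⟨k, i⟩, h, -⟩ := existsUnique_occupies (C := C) e R (ρ := ρ) hb
    let q : ℤ × Color C.prototiles :=
      (cell C.width (2 * C.r * k + i) 0 0, ⟨_, (valid_param he k i).shape_mem⟩)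
    simp only [Set.mem_iUnion]
    exact ⟨q, ⟨k, i, rfl, rfl⟩, (key q k i rfl rfl _ _ _ hb hρ).2 h⟩

/-! ### Every tiling is the tiling of a path, up to a translation -/

section Rigidity

variable {S : Set (ℤ × Color C.prototiles)}

/-- A hole is a single cell between two cells of its own tile, so it is filled by a tab; the extreme
tabs in columns z and 2z then leave no room for a sideways displacement. -/
theorem exists_tile_of_mem_code (hS : IsTiling S) {q : ℤ × Color C.prototiles} (hq : q ∈ S)
    {τ : TileParam Ω} (hτ : C.Valid τ) (hqτ : q.2.val = C.shape τ) {b : ℕ}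
    (hb : b ∈ C.code τ.phase τ.inMark) :
    ∃ q' ∈ S, ∃ τ', C.Valid τ' ∧ q'.2.val = C.shape τ' ∧
      q.1 = q'.1 + cell C.width (C.gap τ'.phase) 0 0 ∧ q.1 + cell C.width 0 b 0 ∈ tile q' := by
  obtain ⟨hb1, hb2, hbw⟩ := mem_width_of_mem_code hb
  have hz := C.z_pos
  obtain ⟨q', hq', hx⟩ := hS.exists_mem (q.1 + cell C.width 0 b 0)
  obtain ⟨τ', hτ', hqτ'⟩ := mem_prototiles.1 q'.2.2
  have hne : q ≠ q' := by
    rintro rfl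
    rw [hτ.cell_mem_tile hqτ hbw (by norm_num), hτ.occupies_zero_iff hbw] at hx
    exact hx hb
  have hR : ∀ R' b' ρ', b' < C.width → ρ' < 3 → C.Occupies τ' R' b' ρ' → ∀ b₁ ρ₁, b₁ < C.width →
      ρ₁ < 3 → q'.1 + cell C.width R' b' ρ' = q.1 + cell C.width 0 b₁ ρ₁ →
      ¬ C.Occupies τ 0 b₁ ρ₁ := by
    intro R' b' ρ' hb' hρ' h' b₁ ρ₁ hb₁ hρ₁ heq h
    rw [← hτ'.cell_mem_tile hqτ' hb' hρ', heq] at h'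
    rw [← hτ.cell_mem_tile hqτ hb₁ hρ₁] at h
    exact hne (hS.eq_of_mem hq hq' h h')
  obtain ⟨R', b', ρ', hb', hρ', hc, ho⟩ := hτ'.mem_shape.1 (hqτ' ▸ mem_tile.1 hx)
  have hc : q.1 + cell C.width 0 b 0 = q'.1 + cell C.width R' b' ρ' := by omega
  -- A piece containing residues 1 and 2 of its column would also cover a neighbour of the hole, on
  -- the right if the hole has residue 0 or 1 in it, on the left if 2. The left neighbour exists in
  -- the row since b ≥ z > 0.
  have hbody : ¬ (∀ ρ₁ < 3, ρ₁ ≠ 0 → C.Occupies τ' R' b' ρ₁) := by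
    intro hall
    have h1 : C.Occupies τ 0 b 1 := Or.inl ⟨rfl, by simp⟩
    have h2 : C.Occupies τ 0 (b - 1) 2 := Or.inl ⟨rfl, by simp⟩
    have hm : q.1 + cell C.width 0 (b - 1) 2 = q.1 + cell C.width 0 b 0 - 1 := by
      unfold cell; rw [Nat.cast_sub (by omega)]; push_cast; ring
    interval_cases ρ'
    · refine hR R' b' 1 hb' (by norm_num) (hall 1 (by norm_num) (by norm_num)) b 1 hbw
        (by norm_num) ?_ h1
      unfold cell at hc ⊢; push_cast at hc ⊢; omega
    · refine hR R' b' 2 hb' (by norm_num) (hall 2 (by norm_num) (by norm_num)) b 1 hbw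
        (by norm_num) ?_ h1
      unfold cell at hc ⊢; push_cast at hc ⊢; omega
    · refine hR R' b' 1 hb' (by norm_num) (hall 1 (by norm_num) (by norm_num)) (b - 1) 2 (by omega)
        (by norm_num) ?_ h2
      rw [hm, hc]; unfold cell; push_cast; ring
  have htab : R' = C.gap τ'.phase ∧ ρ' = 0 ∧ b' ∈ C.code (C.nextPhase τ'.phase) τ'.outMark := by
    rcases ho with ⟨h, -⟩ | h | h
    · exact absurd (fun ρ₁ _ h' => Or.inl ⟨h, fun h'' => h' h''.1⟩) hbody
    · exact absurd (fun ρ₁ _ _ => Or.inr (Or.inl h)) hbody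
    · exact h
  obtain ⟨rfl, rfl, hb'c⟩ := htab
  obtain ⟨hb1', hb2', -⟩ := mem_width_of_mem_code hb'c
  -- All columns involved lie in [z, 2z], so a displaced tab stays within columns 0 to 3z of the
  -- same row. It must meet a hole there, hence lands in [z, 2z] again; for c = z and c = 2z this
  -- forces b = b'.
  have hshift : ∀ c ∈ C.code (C.nextPhase τ'.phase) τ'.outMark, C.z ≤ b + c - b' ∧
      b + c - b' ≤ 2 * C.z := by
    intro c hc'
    obtain ⟨hc1, hc2, hcw⟩ := mem_width_of_mem_code hc'
    have hw : b + c - b' < C.width := by simp only [width]; omega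
    have := hR _ c 0 hcw (by norm_num) (Or.inr (Or.inr ⟨rfl, rfl, hc'⟩)) (b + c - b') 0 hw
      (by norm_num) (by
        unfold cell at hc ⊢
        rw [Nat.cast_sub (by omega)]
        push_cast at hc ⊢
        linarith)
    rw [hτ.occupies_zero_iff hw, not_not] at this
    have := mem_width_of_mem_code this
    omega
  have h1 := hshift _ (C.left_mem_code _ _)
  have h2 := hshift _ (C.right_mem_code _ _)
  have hbb : b = b' := by omega
  subst hbb
  refine ⟨q', hq', τ', hτ', hqτ', ?_, hx⟩
  unfold cell at hc ⊢; push_cast at hc ⊢; linarith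

/-- The tabs of the tile filling the hole in column z are exactly the holes: a tab elsewhere would
overlap the tile, and any tile filling another hole is aligned too, so its tab in column z
identifies it with the first. Injectivity of the code does the rest. -/
theorem exists_pred (hS : IsTiling S) {q : ℤ × Color C.prototiles} (hq : q ∈ S)
    {τ : TileParam Ω} (hτ : C.Valid τ) (hqτ : q.2.val = C.shape τ) :
    ∃ q' ∈ S, ∃ τ', C.Valid τ' ∧ q'.2.val = C.shape τ' ∧
      q.1 = q'.1 + cell C.width (C.gap τ'.phase) 0 0 ∧
      C.nextPhase τ'.phase = τ.phase ∧ τ'.outMark = τ.inMark := by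
  have hz := C.left_mem_code τ.phase τ.inMark
  obtain ⟨q', hq', τ', hτ', hqτ', hs, hx⟩ := exists_tile_of_mem_code hS hq hτ hqτ hz
  refine ⟨q', hq', τ', hτ', hqτ', hs, ?_⟩
  have hs' : ∀ b, q.1 + cell C.width 0 b 0 = q'.1 + cell C.width (C.gap τ'.phase) b 0 := by
    intro b
    rw [hs, add_assoc, cell_add_cell, add_zero]
  apply C.code_inj _ (nextPhase_lt _) _ hτ.phase_lt
  ext b
  constructor
  · intro hb
    have hbw := (mem_width_of_mem_code hb).2.2
    by_contra hc
    have h1 := (hτ'.cell_mem_tile hqτ' hbw (by norm_num)).2 ((hτ'.occupies_gap_iff hbw).2 hb)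
    have h2 := (hτ.cell_mem_tile hqτ hbw (by norm_num)).2 ((hτ.occupies_zero_iff hbw).2 hc)
    rw [hs' b] at h2
    obtain rfl := hS.eq_of_mem hq hq' h2 h1
    have hzw := (mem_width_of_mem_code hz).2.2
    rw [hτ.cell_mem_tile hqτ hzw (by norm_num), hτ.occupies_zero_iff hzw] at hx
    exact hx hz
  · intro hb
    have hbw := (mem_width_of_mem_code hb).2.2
    obtain ⟨q'', hq'', τ'', hτ'', hqτ'', hs'', hx''⟩ := exists_tile_of_mem_code hS hq hτ hqτ hb
    have hzw := (mem_width_of_mem_code hz).2.2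
    have h1 : q''.1 + cell C.width (C.gap τ''.phase) C.z 0 ∈ tile q'' :=
      (hτ''.cell_mem_tile hqτ'' hzw (by norm_num)).2
        ((hτ''.occupies_gap_iff hzw).2 (C.left_mem_code _ _))
    have h2 : q'.1 + cell C.width (C.gap τ'.phase) C.z 0 ∈ tile q' :=
      (hτ'.cell_mem_tile hqτ' hzw (by norm_num)).2
        ((hτ'.occupies_gap_iff hzw).2 (C.left_mem_code _ _))
    have h3 : q''.1 + cell C.width (C.gap τ''.phase) C.z 0 =
        q'.1 + cell C.width (C.gap τ'.phase) C.z 0 := by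
      rw [← hs' C.z, hs'', add_assoc, cell_add_cell, add_zero]
    rw [h3] at h1
    obtain rfl := hS.eq_of_mem hq'' hq' h1 h2
    rw [hs' b, hτ'.cell_mem_tile hqτ' hbw (by norm_num), hτ'.occupies_gap_iff hbw] at hx''
    exact hx''

variable (S) in
/-- The tiling has a tile of phase `i` with data `τ` in the block that starts at `o`. -/
structure HasTile (o : ℤ) (i : ℕ) (τ : TileParam Ω) : Prop where
  valid : C.Valid τ
  phase_eq : τ.phase = i
  exists_mem : ∃ q ∈ S, q.1 = o + cell C.width i 0 0 ∧ q.2.val = C.shape τ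

theorem HasTile.congr (hS : IsTiling S) {o o' : ℤ} {i i' : ℕ} {τ τ' : TileParam Ω}
    (h : HasTile S o i τ) (h' : HasTile S o' i' τ')
    (ho : o + cell C.width i 0 0 = o' + cell C.width i' 0 0) :
    i = i' ∧ τ.inMark = τ'.inMark ∧ ∀ b < C.width, τ.col b = τ'.col b := by
  obtain ⟨q, hq, hq1, hq2⟩ := h.exists_mem
  obtain ⟨q', hq', hq1', hq2'⟩ := h'.exists_mem
  have h0 : q.1 + cell C.width 0 0 0 ∈ tile q :=
    (h.valid.cell_mem_tile hq2 C.width_pos (by norm_num)).2 (occupies_zero_zero τ)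
  have h0' : q'.1 + cell C.width 0 0 0 ∈ tile q' :=
    (h'.valid.cell_mem_tile hq2' C.width_pos (by norm_num)).2 (occupies_zero_zero τ')
  rw [hq1', ← ho, ← hq1] at h0'
  obtain rfl := hS.eq_of_mem hq hq' h0 h0'
  obtain ⟨h1, h2, h3⟩ := h.valid.eq_of_shape_eq h'.valid (hq2.symm.trans hq2')
  exact ⟨by rw [← h.phase_eq, ← h'.phase_eq, h1], h2, h3⟩

theorem HasTile.pred_of_pos (hS : IsTiling S) {o : ℤ} {i : ℕ} {τ : TileParam Ω}
    (h : HasTile S o (i + 1) τ) : ∃ τ', HasTile S o i τ' ∧ τ'.inMark = τ.inMark := by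
  obtain ⟨q, hq, hq1, hq2⟩ := h.exists_mem
  obtain ⟨q', hq', τ', hτ', hqτ', hs, hn, ho⟩ := exists_pred hS hq h.valid hq2
  rw [h.phase_eq] at hn
  rcases gap_cases (C := C) _ hτ'.phase_lt with ⟨hp, hg, hn'⟩ | ⟨-, -, hn'⟩
  · obtain rfl : τ'.phase = i := by omega
    refine ⟨τ', ⟨hτ', rfl, q', hq', ?_, hqτ'⟩, (hτ'.out_eq hp).symm.trans ho⟩
    rw [hg, hq1] at hs
    unfold cell at hs ⊢; push_cast at hs ⊢; linarith
  · omega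

theorem HasTile.pred_of_zero (hS : IsTiling S) {o : ℤ} {τ : TileParam Ω}
    (h : HasTile S o 0 τ) :
    ∃ τ', HasTile S (o - C.period) (C.r - 1) τ' ∧ τ'.outMark = τ.inMark := by
  obtain ⟨q, hq, hq1, hq2⟩ := h.exists_mem
  obtain ⟨q', hq', τ', hτ', hqτ', hs, hn, ho⟩ := exists_pred hS hq h.valid hq2
  rw [h.phase_eq] at hn
  rcases gap_cases (C := C) _ hτ'.phase_lt with ⟨hp, hg, hn'⟩ | ⟨hp, hg, hn'⟩
  · omega
  · refine ⟨τ', ⟨hτ', by omega, q', hq', ?_, hqτ'⟩, ho⟩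
    rw [hg, hq1] at hs
    rw [period_eq_cell, Nat.cast_sub C.r_pos]
    unfold cell at hs ⊢; push_cast at hs ⊢; linarith

theorem HasTile.exists_of_le (hS : IsTiling S) {o : ℤ} {i : ℕ} {τ : TileParam Ω}
    (h : HasTile S o i τ) : ∀ j ≤ i, ∃ τ', HasTile S o j τ' ∧ τ'.inMark = τ.inMark := by
  induction i generalizing τ with
  | zero => intro j hj; obtain rfl : j = 0 := by omega
            exact ⟨τ, h, rfl⟩
  | succ i ih =>
    intro j hj
    rcases hj.eq_or_lt with rfl | hj
    · exact ⟨τ, h, rfl⟩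
    · obtain ⟨τ₁, h₁, h₁'⟩ := h.pred_of_pos hS
      obtain ⟨τ₂, h₂, h₂'⟩ := ih h₁ j (by omega)
      exact ⟨τ₂, h₂, h₂'.trans h₁'⟩

/-- Predecessors never end, and a tile of the last phase has its whole block behind it; so all
blocks to the left of a given tile are complete. -/
theorem HasTile.exists_last (hS : IsTiling S) {o : ℤ} {i : ℕ} {τ : TileParam Ω}
    (h : HasTile S o i τ) (n : ℕ) : ∃ τ', HasTile S (o - (n + 1) * C.period) (C.r - 1) τ' := by
  have step : ∀ (o : ℤ) (i : ℕ) (τ : TileParam Ω), HasTile S o i τ →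
      ∃ τ', HasTile S (o - C.period) (C.r - 1) τ' := by
    intro o i τ h
    obtain ⟨τ₁, h₁, -⟩ := h.exists_of_le hS 0 (Nat.zero_le _)
    obtain ⟨τ₂, h₂, -⟩ := h₁.pred_of_zero hS
    exact ⟨τ₂, h₂⟩
  induction n with
  | zero => simpa using step o i τ h
  | succ n ih =>
    obtain ⟨τ', h'⟩ := ih
    obtain ⟨τ₂, h₂⟩ := step _ _ _ h'
    refine ⟨τ₂, ?_⟩
    convert h₂ using 1
    push_cast; ring

/-- Supplies tiles arbitrarily far to the right, whereas predecessors lead only to the left. -/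
theorem exists_hasTile (hS : IsTiling S) (x : ℤ) :
    ∃ (o : ℤ) (i : ℕ) (τ : TileParam Ω), HasTile S o i τ ∧ x < o + 2 * C.period := by
  obtain ⟨q, hq, hx⟩ := hS.exists_mem x
  obtain ⟨τ, hτ, hqτ⟩ := mem_prototiles.1 q.2.2
  refine ⟨q.1 - cell C.width τ.phase 0 0, τ.phase, τ, ⟨hτ, rfl, q, hq, by ring, hqτ⟩, ?_⟩
  obtain ⟨R, b, ρ, hb, hρ, hc, ho⟩ := hτ.mem_shape.1 (hqτ ▸ mem_tile.1 hx)
  have hR := (hτ.row_bounds hb ho).2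
  have hp := hτ.phase_lt
  have hw := C.width_pos
  have : R + τ.phase + 1 ≤ 4 * C.r := by
    rcases ho with ⟨rfl, -⟩ | h | ⟨h, -, -⟩
    · omega
    · have := hτ.col_lt b hb
      omega
    · rcases gap_cases (C := C) _ hp with ⟨h1, h2, -⟩ | ⟨h1, h2, -⟩ <;> omega
  have h3 : (C.width : ℤ) * (R + τ.phase + 1) ≤ C.width * (4 * C.r) :=
    mul_le_mul_of_nonneg_left this (by positivity)
  rw [period_eq_cell]
  unfold cell at hc ⊢
  push_cast at hc ⊢
  nlinarith

theorem shape_congr {τ τ' : TileParam Ω} (h1 : τ.phase = τ'.phase) (h2 : τ.inMark = τ'.inMark)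
    (h3 : τ.outMark = τ'.outMark) (h4 : ∀ b < C.width, τ.col b = τ'.col b) :
    C.shape τ = C.shape τ' := by
  have : ∀ R b ρ, b < C.width → (C.Occupies τ R b ρ ↔ C.Occupies τ' R b ρ) := by
    intro R b ρ hb
    simp only [Occupies, h1, h2, h3, h4 b hb]
  ext x
  simp only [shape, Finset.mem_filter, and_congr_right_iff]
  intro _
  constructor <;> rintro ⟨R, b, ρ, hb, hρ, hx, h⟩
  · exact ⟨R, b, ρ, hb, hρ, hx, (this _ _ _ hb).1 h⟩
  · exact ⟨R, b, ρ, hb, hρ, hx, (this _ _ _ hb).2 h⟩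

/-- In each column the r tiles of a complete block take disjoint entries among the r rows of the
common region, hence define a permutation; these permutations and the class determine an edge. -/
theorem HasTile.exists_edge (hS : IsTiling S) {o : ℤ} {τ : TileParam Ω}
    (h : HasTile S o (C.r - 1) τ) :
    ∃ e, C.mark e = τ.inMark ∧ ∀ i : Fin C.r, ∃ τ', HasTile S o i τ' ∧
      τ'.inMark = C.mark e ∧ ∀ b < C.width, τ'.col b = C.perm e b i := by
  have hr := C.r_pos
  have : ∀ i : Fin C.r, ∃ τ', HasTile S o i τ' ∧ τ'.inMark = τ.inMark := fun i =>
    h.exists_of_le hS i (by omega)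
  choose f hf hfm using this
  have hinj : ∀ b (hb : b < C.width),
      Function.Injective fun i => (⟨(f i).col b, (hf i).valid.col_lt b hb⟩ : Fin C.r) := by
    intro b hb i i' heq
    have heq : (f i).col b = (f i').col b := congrArg Fin.val heq
    obtain ⟨q, hq, hq1, hq2⟩ := (hf i).exists_mem
    obtain ⟨q', hq', hq1', hq2'⟩ := (hf i').exists_mem
    have h1 := ((hf i).valid.cell_mem_tile hq2 hb (by norm_num : 1 < 3)
      (R := C.r + (f i).col b - i)).2 (Or.inr (Or.inl (by rw [(hf i).phase_eq]; ring)))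
    have h2 := ((hf i').valid.cell_mem_tile hq2' hb (by norm_num : 1 < 3)
      (R := C.r + (f i').col b - i')).2 (Or.inr (Or.inl (by rw [(hf i').phase_eq]; ring)))
    rw [hq1, add_assoc, cell_add_cell, add_sub_cancel] at h1
    rw [hq1', add_assoc, cell_add_cell, add_sub_cancel, ← heq] at h2
    obtain rfl := hS.eq_of_mem hq hq' h1 h2
    have := (cell_inj C.width_pos C.width_pos (by norm_num) (by norm_num)
      (add_left_cancel (hq1.symm.trans hq1'))).1
    exact Fin.ext (by exact_mod_cast this)
  let π : ℕ → Equiv.Perm (Fin C.r) := fun b =>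
    if hb : b < C.width then Equiv.ofBijective _ (Finite.injective_iff_bijective.1 (hinj b hb))
    else 1
  have hπ : ∀ b (hb : b < C.width) i, (π b i : ℕ) = (f i).col b := by
    intro b hb i
    simp [π, hb]
  obtain ⟨e, he1, he2⟩ := C.exists_perm_eq τ.inMark π fun b hb => by
    by_cases hbw : b < C.width
    · ext i
      rw [hπ b hbw, (hf i).valid.col_eq b hbw (by rwa [hfm i]), (hf i).phase_eq]
      rfl
    · exact dif_neg hbw
  refine ⟨e, he1, fun i => ⟨f i, hf i, (hfm i).trans he1.symm, fun b hb => ?_⟩⟩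
  rw [he2, hπ b hb]

/-- Far to the left, a first tile of the second family starts inside a complete block of the first.
That block is already covered by its own tiles and the tabs of the one before it, so this tile is
among them. -/
theorem HasTile.exists_eq_add (hS : IsTiling S) {o o' : ℤ} {i i' : ℕ} {τ τ' : TileParam Ω}
    (h : HasTile S o i τ) (h' : HasTile S o' i' τ') : ∃ n : ℤ, o' = o + n * C.period := by
  have hr := C.r_pos
  have hM : (0 : ℤ) < C.period := by exact_mod_cast C.period_pos
  -- Enough periods to pass to the left of `o`, where the blocks of the first family are known to be
  -- complete.
  obtain ⟨τ₁, h₁⟩ := h'.exists_last hS (o' - o).natAbs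
  obtain ⟨τ₂, h₂, -⟩ := h₁.exists_of_le hS 0 (Nat.zero_le _)
  obtain ⟨k, w, hw, hk⟩ := exists_eq_mul_add C.period_pos
    (o' - ((o' - o).natAbs + 1) * C.period - o)
  have hk0 : k < 0 := by
    by_contra! hk0
    have h1 : o' - o ≤ (o' - o).natAbs := by omega
    nlinarith [mul_nonneg hM.le hk0, mul_le_mul_of_nonneg_left (show (1 : ℤ) ≤ C.period by omega)
      (show (0 : ℤ) ≤ (o' - o).natAbs by omega)]
  obtain ⟨n, rfl⟩ : ∃ n : ℕ, k = -(n + 1) := ⟨(-k - 1).toNat, by omega⟩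
  obtain ⟨τ₃, h₃⟩ := h.exists_last hS n
  obtain ⟨e, he, hf⟩ := h₃.exists_edge hS
  choose f hf hfm hfc using hf
  obtain ⟨τ₄, h₄, h₄'⟩ := (hf ⟨0, hr⟩).pred_of_zero hS
  set o₁ := o - (n + 1) * C.period with ho₁
  have ho'' : o' - ((o' - o).natAbs + 1) * C.period = o₁ + w := by linarith
  rw [ho''] at h₂
  obtain ⟨R, b, ρ, hb, hρ, hwc⟩ := exists_eq_cell C.width_pos (w : ℤ)
  obtain ⟨v, hv, rfl⟩ : ∃ v : ℕ, v < 2 * C.r ∧ R = v := by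
    have hw' : (w : ℤ) < C.period := by exact_mod_cast hw
    rw [period_eq_cell, hwc] at hw'
    have hw0 : (0 : ℤ) ≤ w := by positivity
    rw [hwc] at hw0
    unfold cell at hw0 hw'
    push_cast at hw' hw0
    have hW : (0 : ℤ) < C.width := by exact_mod_cast C.width_pos
    have h1 : (-1 : ℤ) < R := by
      by_contra! hR
      nlinarith
    have h2 : R < 2 * C.r := by
      by_contra! hR
      nlinarith
    exact ⟨R.toNat, by omega, by omega⟩
  -- Only block 0 and the last tile of block -1 matter for covering block 0; the other values are
  -- arbitrary.
  let g : ℤ → ℕ → TileParam Ω := fun k i =>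
    if k = 0 then (if h : i < C.r then f ⟨i, h⟩ else τ) else τ₄
  have hg : ∀ i (h : i < C.r), g 0 i = f ⟨i, h⟩ := fun i h => by simp [g, h]
  have hg' : g (0 - 1) (C.r - 1) = τ₄ := by simp [g]
  obtain ⟨k', i₁, hk', hi₁, ho⟩ := exists_occupies (C := C) (ρ := ρ) g 0 (C.mark e)
    (fun i hi => by
      rw [hg i hi]
      refine ⟨(hf ⟨i, hi⟩).phase_eq, hfm _, fun hi' => ?_⟩
      rw [(hf ⟨i, hi⟩).valid.out_eq (by rwa [(hf ⟨i, hi⟩).phase_eq]), hfm])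
    (by
      rw [hg', h₄', hfm]
      exact ⟨h₄.phase_eq, rfl⟩)
    (fun b hb j hj => ⟨(C.perm e b).symm ⟨j, hj⟩, Fin.is_lt _, by
      rw [hg _ (Fin.is_lt _), hfc _ _ hb]; simp⟩) hv hb
  obtain ⟨i₂, hT⟩ : ∃ i₂, HasTile S (o₁ + k' * C.period) i₂ (g k' i₁) ∧
      C.Occupies (g k' i₁) (v - (2 * C.r * k' + i₂)) b ρ := by
    rcases hk' with rfl | ⟨rfl, rfl⟩
    · refine ⟨i₁, ?_, by simpa using ho⟩
      rw [hg i₁ hi₁]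
      simpa using hf ⟨i₁, hi₁⟩
    · refine ⟨C.r - 1, ?_, by rw [Nat.cast_sub hr] at ho ⊢; simpa using ho⟩
      rw [hg']
      simpa [sub_eq_add_neg] using h₄
  obtain ⟨q, hq, hq1, hq2⟩ := hT.1.exists_mem
  obtain ⟨q', hq', hq1', hq2'⟩ := h₂.exists_mem
  have hm := (hT.1.valid.cell_mem_tile hq2 hb hρ).2 hT.2
  have hm' : q'.1 + cell C.width 0 0 0 ∈ tile q' :=
    (h₂.valid.cell_mem_tile hq2' C.width_pos (by norm_num)).2 (occupies_zero_zero _)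
  have heq : q.1 + cell C.width (v - (2 * C.r * k' + i₂)) b ρ =
      q'.1 + cell C.width 0 0 0 := by
    rw [hq1, hq1', hwc, period_eq_cell]
    unfold cell; push_cast; ring
  rw [heq] at hm
  -- The cell is the start of `q'`, so the tile covering it is `q'` itself. Equal phases then force
  -- `i₂ = 0`, and `w` is a multiple of the period.
  obtain rfl := hS.eq_of_mem hq hq' hm hm'
  obtain ⟨rfl, -⟩ := hT.1.congr hS h₂ (hq1.symm.trans hq1')
  have h5 := hq1.symm.trans hq1'
  refine ⟨k' - (n + 1) + ((o' - o).natAbs + 1), ?_⟩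
  have h6 : o₁ + k' * C.period = o₁ + w := add_right_cancel h5
  linarith

/-- Every tiling is the tiling of a path, up to a translation. -/
theorem exists_path_of_isTiling (hS : IsTiling S) :
    ∃ (o : ℤ) (e : ℤ → E), IsPath src tgt e ∧ ∀ q ∈ C.pathTiling e, (q.1 + o, q.2) ∈ S := by
  have hr := C.r_pos
  have hM : (0 : ℤ) < C.period := by exact_mod_cast C.period_pos
  obtain ⟨o, i, τ, h, -⟩ := exists_hasTile hS 0
  have hall : ∀ k : ℤ, ∃ τ, HasTile S (o + k * C.period) (C.r - 1) τ := by
    intro k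
    -- The block found begins less than two periods before this point, hence to the right of block
    -- `k`, which is then complete.
    obtain ⟨o', i', τ', h', hlt⟩ := exists_hasTile hS (o + (k + 3) * C.period)
    obtain ⟨n, rfl⟩ := h.exists_eq_add hS h'
    have hn : k + 3 < n + 2 := by
      by_contra! hn
      nlinarith
    obtain ⟨τ₁, h₁⟩ := h'.exists_last hS (n - k - 1).toNat
    refine ⟨τ₁, ?_⟩
    convert h₁ using 1
    rw [Int.toNat_of_nonneg (by omega)]
    ring
  have hall' : ∀ k : ℤ, ∃ e, ∀ i : Fin C.r, ∃ τ', HasTile S (o + k * C.period) i τ' ∧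
      τ'.inMark = C.mark e ∧ ∀ b < C.width, τ'.col b = C.perm e b i := fun k => by
    obtain ⟨τ, h⟩ := hall k
    obtain ⟨e, -, he⟩ := h.exists_edge hS
    exact ⟨e, he⟩
  choose e he using hall'
  -- The predecessor of the first tile of block `k + 1` starts where the last tile of block `k`
  -- does, so they agree; this reads off the announced class.
  have hlast : ∀ k : ℤ, ∃ τ', HasTile S (o + k * C.period) (C.r - 1) τ' ∧
      τ'.inMark = C.mark (e k) ∧ τ'.outMark = C.mark (e (k + 1)) ∧
      ∀ b < C.width, τ'.col b = C.perm (e k) b ⟨C.r - 1, by omega⟩ := by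
    intro k
    obtain ⟨τ₀, h₀, h₀', -⟩ := he (k + 1) ⟨0, hr⟩
    obtain ⟨τ₁, h₁, h₁'⟩ := h₀.pred_of_zero hS
    rw [show o + (k + 1) * (C.period : ℤ) - C.period = o + k * C.period by ring] at h₁
    obtain ⟨τ₂, h₂, h₂', h₂''⟩ := he k ⟨C.r - 1, by omega⟩
    obtain ⟨-, h3, h4⟩ := h₁.congr hS h₂ rfl
    exact ⟨τ₁, h₁, h3.trans h₂', h₁'.trans h₀', fun b hb => (h4 b hb).trans (h₂'' b hb)⟩
  refine ⟨o, e, fun k => ?_, ?_⟩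
  · obtain ⟨τ', h', h1, h2, -⟩ := hlast k
    have := h'.valid.link (by rw [h'.phase_eq]; omega)
    rwa [h1, h2, C.target_mark, C.source_mark] at this
  · rintro ⟨t, p⟩ ⟨k, i, h1, h2⟩
    obtain ⟨τ', h', hsh⟩ : ∃ τ', HasTile S (o + k * C.period) i τ' ∧
        C.shape τ' = C.shape (C.param e k i) := by
      by_cases hi : (i : ℕ) + 1 < C.r
      · obtain ⟨τ', h', h3, h4⟩ := he k i
        refine ⟨τ', h', shape_congr h'.phase_eq h3 ?_ h4⟩
        rw [h'.valid.out_eq (by rwa [h'.phase_eq]), h3]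
        simp [param, hi]
      · obtain ⟨τ', h', h3, h4, h5⟩ := hlast k
        obtain ⟨i, hir⟩ := i
        obtain rfl : i = C.r - 1 := by simp only at hi; omega
        refine ⟨τ', h', shape_congr h'.phase_eq h3 ?_ h5⟩
        rw [h4]
        exact (if_neg hi).symm
    obtain ⟨q, hq, hq1, hq2⟩ := h'.exists_mem
    convert hq using 1
    refine Prod.ext ?_ (Subtype.ext ?_)
    · simp only at h1 ⊢
      rw [hq1, h1, period_eq_cell]
      unfold cell; push_cast; ring
    · rw [hq2, hsh]; exact h2

end Rigidity

end TileCoding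

/-! ### The coloring of a tiling -/

theorem IsTiling.exists_coloring {P : Finset (Finset ℤ)} {S : Set (ℤ × Color P)}
    (hS : IsTiling S) :
    ∃ x : ℤ → Color P, ∀ i k, x i = k ↔ ∃ q ∈ S, i ∈ tile q ∧ q.2 = k := by
  choose f hf hf' using hS.exists_mem
  refine ⟨fun i => (f i).2, fun i k => ⟨fun h => ⟨f i, hf i, hf' i, h⟩, ?_⟩⟩
  rintro ⟨q, hq, hi, rfl⟩
  exact congrArg Prod.snd (hS.eq_of_mem (hf i) hq (hf' i) hi)

theorem mem_tile_add {P : Finset (Finset ℤ)} {q : ℤ × Color P} {i n : ℤ} :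
    i + n ∈ tile (q.1 + n, q.2) ↔ i ∈ tile q := by
  rw [mem_tile, mem_tile, add_sub_add_right_eq_sub]

theorem shift_mem_tilingSpace {P : Finset (Finset ℤ)} {x : ℤ → Color P}
    (hx : x ∈ tilingSpace P) (n : ℤ) : shift n x ∈ tilingSpace P := by
  obtain ⟨S, hS, hxS⟩ := hx
  refine ⟨{q | (q.1 + n, q.2) ∈ S}, ⟨?_, ?_⟩, fun i k => ?_⟩
  · intro q hq q' hq' hne
    refine Set.disjoint_left.2 fun i hi hi' => hne ?_
    have := hS.eq_of_mem hq hq' (mem_tile_add.2 hi) (mem_tile_add.2 hi')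
    simp only [Prod.mk.injEq, add_left_inj] at this
    exact Prod.ext this.1 this.2
  · refine Set.eq_univ_of_forall fun i => ?_
    obtain ⟨q, hq, hi⟩ := hS.exists_mem (i + n)
    simp only [Set.mem_iUnion]
    refine ⟨(q.1 - n, q.2), by simpa using hq, mem_tile_add (n := n) |>.1 ?_⟩
    simpa using hi
  · rw [shift_apply, add_comm, hxS]
    constructor
    · rintro ⟨q, hq, hi, hk⟩
      refine ⟨(q.1 - n, q.2), by simpa using hq, mem_tile_add (n := n) |>.1 ?_, hk⟩
      simpa using hi
    · rintro ⟨q, hq, hi, hk⟩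
      exact ⟨_, hq, mem_tile_add.2 hi, hk⟩

theorem iterate_shift_one {A : Type*} (n : ℕ) (x : ℤ → A) :
    (shift (1 : ℤ))^[n] x = shift (n : ℤ) x := by
  induction n generalizing x with
  | zero => simp
  | succ n ih => rw [Function.iterate_succ_apply, ih, ← shift_add, Nat.cast_succ, add_comm]

/-! ### From paths to the cyclic parts of the tiling system -/

namespace TileCoding

variable {E V Ω : Type*} {src tgt : E → V} {C : TileCoding src tgt Ω}

theorem add_mem_pathTiling {e e' : ℤ → E} {a : ℤ} (h : ∀ k, e' k = e (k + a))
    {q : ℤ × Color C.prototiles} (hq : q ∈ C.pathTiling e') :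
    (q.1 + a * C.period, q.2) ∈ C.pathTiling e := by
  obtain ⟨k, i, h1, h2⟩ := hq
  refine ⟨k + a, i, ?_, ?_⟩
  · simp only [h1, period_eq_cell]
    unfold cell; push_cast; ring
  · have : C.param e (k + a) i = C.param e' k i := by
      simp only [param, h]
      rw [add_right_comm]
    rw [this]; exact h2

theorem coloring_start {e : ℤ → E} (he : IsPath src tgt e) {x : ℤ → Color C.prototiles}
    (hx : ∀ i k, x i = k ↔ ∃ q ∈ C.pathTiling e, i ∈ tile q ∧ q.2 = k) (k : ℤ) (i : Fin C.r) :
    (x (cell C.width (2 * C.r * k + i) 0 0)).val = C.shape (C.param e k i) := by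
  have hv := valid_param (C := C) he k i
  rw [(hx _ ⟨_, hv.shape_mem⟩).2 ⟨(cell C.width (2 * C.r * k + i) 0 0, ⟨_, hv.shape_mem⟩),
    ⟨k, i, rfl, rfl⟩, ?_, rfl⟩]
  rw [mem_tile, sub_self]
  exact hv.isLeast_shape.1

/-- A system that is conjugate to the shift on the paths of a finite directed graph with a coding
is conjugate to a power of the shift on the cyclic parts of a tiling system. -/
theorem exists_conjugacy {Y : Type*} [TopologicalSpace Y] [CompactSpace Y] (φ : Y → Y)
    (g : Y → ℤ → E) (hloc : ∀ k, IsLocallyConstant fun y => g y k) (hinj : Function.Injective g)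
    (hrange : ∀ e, IsPath src tgt e ↔ ∃ y, g y = e) (hφ : ∀ y k, g (φ y) k = g y (k + 1)) :
    ∃ T : ZMod C.period → Set (ℤ → Color C.prototiles),
      tilingSpace C.prototiles = ⋃ i, T i ∧
      (∀ i, IsClosed (T i)) ∧
      (∀ i, shift (1 : ℤ) '' T i = T (i + 1)) ∧
      ∀ i, ∃ hi : Set.MapsTo (shift (1 : ℤ))^[C.period] (T i) (T i),
        TopologicallyConjugate φ hi.restrict := by
  have hpath : ∀ y, IsPath src tgt (g y) := fun y => (hrange _).2 ⟨y, rfl⟩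
  have htil : ∀ y, IsTiling (C.pathTiling (g y)) := fun y => isTiling_pathTiling (hpath y)
  choose h hh using fun y => (htil y).exists_coloring
  have hshift : ∀ (y y' : Y) (a : ℤ), (∀ k, g y' k = g y (k + a)) →
      h y' = shift (a * C.period) (h y) := by
    intro y y' a ha
    funext j
    obtain ⟨q, hq, hj, hk⟩ := (hh y' j _).1 rfl
    rw [shift_apply, eq_comm, add_comm, hh]
    exact ⟨_, add_mem_pathTiling ha hq, mem_tile_add.2 hj, hk⟩
  have hinj' : Function.Injective h := by
    intro y y' heq
    apply hinj
    funext k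
    have key : ∀ i : Fin C.r, C.mark (g y k) = C.mark (g y' k) ∧
        ∀ b < C.width, (C.perm (g y k) b i : ℕ) = C.perm (g y' k) b i := by
      intro i
      have h1 := coloring_start (hpath y) (hh y) k i
      rw [heq, coloring_start (hpath y') (hh y') k i] at h1
      obtain ⟨-, h2, h3⟩ := (valid_param (hpath y) k i).eq_of_shape_eq
        (valid_param (hpath y') k i) h1.symm
      exact ⟨h2, h3⟩
    have hm := (key ⟨0, C.r_pos⟩).1
    refine C.eq_of_perm_eq _ _ hm (funext fun b => ?_)
    by_cases hb : b < C.width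
    · exact Equiv.ext fun i => Fin.ext ((key i).2 b hb)
    · have h4 : ∀ e, C.perm e b = 1 := fun e =>
        C.perm_eq_one e b ((C.free_le _).trans (not_lt.1 hb))
      rw [h4, h4]
  -- The color at `j` is determined by one tile, which depends on two consecutive edges only.
  have hcont : Continuous h := by
    refine continuous_pi fun j => IsLocallyConstant.continuous ?_
    rw [IsLocallyConstant.iff_eventually_eq]
    intro y
    obtain ⟨q, ⟨k, i, h1, h2⟩, hj, hk⟩ := (hh y j _).1 rfl
    filter_upwards [(IsLocallyConstant.iff_eventually_eq _).1 (hloc k) y,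
      (IsLocallyConstant.iff_eventually_eq _).1 (hloc (k + 1)) y] with y' hy1 hy2
    rw [hh]
    refine ⟨q, ⟨k, i, h1, ?_⟩, hj, hk⟩
    have : C.param (g y') k i = C.param (g y) k i := by
      simp only [param, hy1, hy2]
    rw [this]; exact h2
  have hmove : ∀ y (a : ℤ), ∃ y', h y' = shift (a * C.period) (h y) := by
    intro y a
    obtain ⟨y', hy'⟩ := (hrange fun k => g y (k + a)).1 fun k => by
      have := hpath y (k + a)
      rwa [add_right_comm] at this
    exact ⟨y', hshift y y' a fun k => congrFun hy' k⟩
  -- Shifting by a period maps the image of `h` to itself, by `hmove`, so one representative of the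
  -- residue class gives the whole part.
  let T : ZMod C.period → Set (ℤ → Color C.prototiles) := fun i =>
    {x | ∃ n : ℤ, (n : ZMod C.period) = i ∧ ∃ y, shift n (h y) = x}
  have hT : ∀ n : ℤ, T n = Set.range fun y => shift n (h y) := by
    intro n
    ext x
    constructor
    · rintro ⟨n', hn', y, rfl⟩
      obtain ⟨a, ha⟩ := (ZMod.intCast_eq_intCast_iff_dvd_sub _ _ _).1 hn'.symm
      obtain ⟨y', hy'⟩ := hmove y a
      refine ⟨y', ?_⟩
      simp only
      rw [hy', ← shift_add]
      congr 1
      linarith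
    · rintro ⟨y, rfl⟩
      exact ⟨n, rfl, y, rfl⟩
  refine ⟨T, ?_, fun i => ?_, fun i => ?_, fun i => ?_⟩
  · ext x
    simp only [Set.mem_iUnion]
    constructor
    · rintro ⟨S, hS, hx⟩
      obtain ⟨o, e, he, hsub⟩ := exists_path_of_isTiling hS
      obtain ⟨y, rfl⟩ := (hrange e).1 he
      refine ⟨_, -o, rfl, y, funext fun j => ?_⟩
      obtain ⟨q, hq, hj, hk⟩ := (hh y (-o + j) _).1 rfl
      rw [shift_apply, eq_comm, hx]
      refine ⟨_, hsub q hq, ?_, hk⟩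
      have := mem_tile_add (n := o).2 hj
      rwa [neg_add_cancel_comm] at this
    · rintro ⟨-, n, -, y, rfl⟩
      exact shift_mem_tilingSpace ⟨_, htil y, hh y⟩ n
  · obtain ⟨n, rfl⟩ := ZMod.intCast_surjective i
    rw [hT]
    exact (isCompact_range ((continuous_shift n).comp hcont)).isClosed
  · obtain ⟨n, rfl⟩ := ZMod.intCast_surjective i
    have : (n : ZMod C.period) + 1 = ((n + 1 : ℤ) : ZMod C.period) := by push_cast; rfl
    rw [this, hT, hT, ← Set.range_comp]
    congr 1
    funext y
    exact (shift_add n 1 (h y)).symm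
  · obtain ⟨n, rfl⟩ := ZMod.intCast_surjective i
    have hφ' : ∀ y, h (φ y) = shift (C.period : ℤ) (h y) := fun y => by
      simpa using hshift y (φ y) 1 (hφ y)
    have hsemi : ∀ y, shift n (h (φ y)) = (shift (1 : ℤ))^[C.period] (shift n (h y)) := fun y => by
      rw [hφ', iterate_shift_one, ← shift_add, ← shift_add, add_comm]
    have hmaps : Set.MapsTo (shift (1 : ℤ))^[C.period] (T n) (T n) := by
      rw [hT]
      rintro _ ⟨y, rfl⟩
      exact ⟨φ y, hsemi y⟩
    have hmem : ∀ y, shift n (h y) ∈ T n := fun y => ⟨n, rfl, y, rfl⟩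
    let F : Y → T n := fun y => ⟨shift n (h y), hmem y⟩
    have hF : Function.Bijective F := by
      constructor
      · intro y y' heq
        apply hinj'
        have := congrArg (fun x : T n => shift (-n) x.1) heq
        simpa [F, ← shift_add] using this
      · rintro ⟨x, hx⟩
        have hx' := hx
        rw [hT] at hx'
        obtain ⟨y, rfl⟩ := hx'
        exact ⟨y, rfl⟩
    have hFc : Continuous (Equiv.ofBijective F hF) :=
      ((continuous_shift n).comp hcont).subtype_mk _
    exact ⟨hmaps, hFc.homeoOfEquivCompactToT2, fun y => Subtype.ext (hsemi y)⟩

end TileCoding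

/-! ### Existence of codings -/

/-- A set with fewer than `Q ^ B` elements is partitioned into sets whose cardinalities are powers
of `Q`, with fewer than `Q` sets for each of the exponents below `B`. -/
theorem exists_partition_pow (Q B N : ℕ) (hN : N < Q ^ B) :
    ∃ f : ℕ → ℕ × ℕ, ∀ n < N, (f n).1 < B ∧ (f n).2 < Q ∧
      ((Finset.range N).filter fun n' => f n' = f n).card = Q ^ (f n).1 := by
  induction B generalizing N with
  | zero => exact ⟨fun _ => 0, fun n hn => by simp at hN; omega⟩
  | succ B ih =>
    have hQ : 0 < Q ^ B := by
      rcases Nat.eq_zero_or_pos Q with rfl | h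
      · simp at hN
      · positivity
    obtain ⟨f, hf⟩ := ih (N % Q ^ B) (Nat.mod_lt _ hQ)
    -- The leading base-`Q` digit gives intervals of length `Q ^ B`, labelled by exponent `B` and
    -- their index; the remainder uses only smaller exponents, so labels do not mix.
    set D := Q ^ B * (N / Q ^ B) with hD
    have hND : D + N % Q ^ B = N := Nat.div_add_mod N (Q ^ B)
    have hDN : D ≤ N := hND ▸ Nat.le_add_right _ _
    have hlow : ∀ n, n < D → n / Q ^ B < N / Q ^ B := fun n hn =>
      (Nat.div_lt_iff_lt_mul hQ).2 (by rwa [mul_comm])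
    let g : ℕ → ℕ × ℕ := fun n => if n < D then (B, n / Q ^ B) else f (n - D)
    have hg1 : ∀ n, n < D → g n = (B, n / Q ^ B) := fun n hn => if_pos hn
    have hg2 : ∀ n, ¬ n < D → g n = f (n - D) := fun n hn => if_neg hn
    refine ⟨g, fun n hn => ?_⟩
    by_cases hnD : n < D
    · rw [hg1 n hnD]
      refine ⟨Nat.lt_succ_self B, ?_, ?_⟩
      · refine (hlow n hnD).trans_le (Nat.lt_succ_iff.1 ?_)
        have : N / Q ^ B < Q := (Nat.div_lt_iff_lt_mul hQ).2 (by rwa [pow_succ'] at hN)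
        omega
      · have : ((Finset.range N).filter fun n' => g n' = (B, n / Q ^ B)) =
            Finset.Ico (Q ^ B * (n / Q ^ B)) (Q ^ B * (n / Q ^ B + 1)) := by
          ext n'
          have hiff : n' / Q ^ B = n / Q ^ B ↔
              Q ^ B * (n / Q ^ B) ≤ n' ∧ n' < Q ^ B * (n / Q ^ B + 1) := by
            rw [Nat.div_eq_iff hQ, Nat.mul_comm (Q ^ B), Nat.mul_comm (Q ^ B), Nat.add_mul]
            omega
          have hle : Q ^ B * (n / Q ^ B + 1) ≤ D :=
            Nat.mul_le_mul_left _ (hlow n hnD)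
          simp only [Finset.mem_filter, Finset.mem_range, Finset.mem_Ico]
          constructor
          · rintro ⟨h1, h2⟩
            by_cases h3 : n' < D
            · rw [hg1 n' h3] at h2
              exact hiff.1 (Prod.mk.inj h2).2
            · rw [hg2 n' h3] at h2
              have := (hf (n' - D) (by omega)).1
              rw [h2] at this
              exact absurd this (lt_irrefl _)
          · intro h
            exact ⟨by omega, by rw [hg1 n' (by omega), hiff.2 h]⟩
        rw [this, Nat.card_Ico, ← Nat.mul_sub, Nat.add_sub_cancel_left, mul_one]
    · rw [hg2 n hnD]
      obtain ⟨h1, h2, h3⟩ := hf (n - D) (by omega)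
      refine ⟨by omega, h2, ?_⟩
      rw [← h3]
      symm
      refine Finset.card_bij (fun a _ => a + D) ?_ ?_ ?_
      · intro a ha
        simp only [Finset.mem_filter, Finset.mem_range] at ha ⊢
        exact ⟨by omega, by rw [hg2 _ (by omega), Nat.add_sub_cancel, ha.2]⟩
      · intro a _ a' _ h; omega
      · intro a ha
        simp only [Finset.mem_filter, Finset.mem_range] at ha
        have haD : ¬ a < D := by
          intro haD
          have := ha.2
          rw [hg1 a haD] at this
          rw [← this] at h1
          exact absurd h1 (lt_irrefl _)
        refine ⟨a - D, ?_, by omega⟩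
        simp only [Finset.mem_filter, Finset.mem_range]
        exact ⟨by omega, by rw [← hg2 a haD, ha.2]⟩

theorem exists_partition_pow' {E V : Type*} [Finite E] (src tgt : E → V) (Q B : ℕ)
    (hE : Nat.card E < Q ^ B) :
    ∃ p : E → ℕ × ℕ, ∀ e, (p e).1 < B ∧ (p e).2 < Q ∧
      Nat.card {e' // (src e', tgt e', p e') = (src e, tgt e, p e)} = Q ^ (p e).1 := by
  classical
  let F : V × V → Type _ := fun w => {e : E // (src e, tgt e) = w}
  have hF : ∀ w, Nat.card (F w) < Q ^ B := fun w =>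
    (Nat.card_le_card_of_injective _ Subtype.val_injective).trans_lt hE
  choose f hf using fun w => exists_partition_pow Q B (Nat.card (F w)) (hF w)
  let idx : ∀ w, F w ≃ Fin (Nat.card (F w)) := fun w => Finite.equivFin _
  let p : E → ℕ × ℕ := fun e => f (src e, tgt e) (idx (src e, tgt e) ⟨e, rfl⟩)
  have hp : ∀ w (x : F w), p x.1 = f w (idx w x) := by
    rintro _ ⟨e, rfl⟩
    rfl
  refine ⟨p, fun e => ?_⟩
  obtain ⟨h1, h2, h3⟩ := hf (src e, tgt e) (idx _ ⟨e, rfl⟩) (Fin.is_lt _)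
  refine ⟨h1, h2, ?_⟩
  change _ = Q ^ (f (src e, tgt e) (idx _ ⟨e, rfl⟩)).1
  rw [← h3, ← Fintype.card_coe, ← Nat.card_eq_fintype_card]
  have hfst : ∀ {e'}, (src e', tgt e', p e') = (src e, tgt e, p e) →
      (src e', tgt e') = (src e, tgt e) := fun h => by
    simp only [Prod.mk.injEq] at h ⊢
    exact ⟨h.1, h.2.1⟩
  refine Nat.card_eq_of_bijective (fun e' => ⟨idx (src e, tgt e) ⟨e'.1, hfst e'.2⟩, ?_⟩) ⟨?_, ?_⟩
  · rw [Finset.mem_filter, Finset.mem_range]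
    refine ⟨Fin.is_lt _, ?_⟩
    rw [← hp]
    exact (Prod.mk.inj (Prod.mk.inj e'.2).2).2
  · intro e₁ e₂ h
    have h := (idx (src e, tgt e)).injective (Fin.ext (congrArg Subtype.val h))
    have h := Subtype.ext_iff.1 h
    exact Subtype.ext h
  · rintro ⟨n, hn⟩
    rw [Finset.mem_filter, Finset.mem_range] at hn
    obtain ⟨x, hx⟩ := (idx (src e, tgt e)).surjective ⟨n, hn.1⟩
    have hpx := hp _ x
    rw [hx] at hpx
    have hx2 := Prod.mk.inj x.2
    refine ⟨⟨x.1, ?_⟩, Subtype.ext ?_⟩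
    · rw [hx2.1, hx2.2, hpx]
      exact congrArg _ (congrArg _ hn.2)
    · exact congrArg Fin.val hx

/-- The sequences of permutations that are trivial from `q` on. -/
def permSeqEquiv (r q : ℕ) :
    {π : ℕ → Equiv.Perm (Fin r) // ∀ b, q ≤ b → π b = 1} ≃ (Fin q → Equiv.Perm (Fin r)) where
  toFun π b := π.1 b
  invFun π := ⟨fun b => if h : b < q then π ⟨b, h⟩ else 1, fun b hb => dif_neg (not_lt.2 hb)⟩
  left_inv π := by
    ext b : 2
    by_cases hb : b < q
    · simp [hb]
    · simp [hb, π.2 b (not_lt.1 hb)]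
  right_inv π := by
    funext b
    simp

/-- A class records source, target, exponent and digit index; with exponent q it has (r!)^q edges,
as many as sequences of q permutations. The z - 1 columns strictly between z and 2z provide 2^(z-1)
codes for the pairs of a phase and a class. -/
theorem exists_tileCoding {E : Type*} {V : Type u} [Finite E] [Finite V] (src tgt : E → V) {r z : ℕ}
    (hr : 0 < r) (hz : 0 < z) (hE : Nat.card E < r.factorial ^ (3 * z + 1))
    (hcode : r * (Nat.card V * (Nat.card V * ((3 * z + 1) * r.factorial))) ≤ 2 ^ (z - 1)) :
    ∃ (Ω : Type u) (C : TileCoding src tgt Ω), C.r = r ∧ C.z = z := by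
  classical
  obtain ⟨p, hp⟩ := exists_partition_pow' src tgt _ _ hE
  let cls : E → V × V × ℕ × ℕ := fun e => (src e, tgt e, p e)
  let Ω := Set.range cls
  let mark : E → Ω := fun e => ⟨cls e, e, rfl⟩
  have hcard : ∀ ω : Ω, Nat.card {e // mark e = ω} =
      Nat.card {π : ℕ → Equiv.Perm (Fin r) // ∀ b, ω.1.2.2.1 ≤ b → π b = 1} := by
    rintro ⟨_, e, rfl⟩
    rw [Nat.card_congr (permSeqEquiv r _), Nat.card_fun, Nat.card_perm, Nat.card_fin,
      Nat.card_fin]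
    refine Eq.trans ?_ (hp e).2.2
    exact Nat.card_congr (Equiv.subtypeEquivRight fun e' => Subtype.ext_iff)
  have : ∀ ω : Ω, Finite {π : ℕ → Equiv.Perm (Fin r) // ∀ b, ω.1.2.2.1 ≤ b → π b = 1} :=
    fun ω => Finite.of_equiv _ (permSeqEquiv r _).symm
  have Ψ : ∀ ω : Ω, {e // mark e = ω} ≃
      {π : ℕ → Equiv.Perm (Fin r) // ∀ b, ω.1.2.2.1 ≤ b → π b = 1} := fun ω =>
    haveI : Finite {e // mark e = ω} := Subtype.finite
    (Finite.equivFinOfCardEq (hcard ω)).trans (Finite.equivFin _).symm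
  have hΨ : ∀ e ω (h : mark e = ω), (Ψ (mark e) ⟨e, rfl⟩).1 = (Ψ ω ⟨e, h⟩).1 := by
    rintro e _ rfl
    rfl
  have hΩ : Nat.card Ω ≤ Nat.card V * (Nat.card V * ((3 * z + 1) * r.factorial)) := by
    have : ∀ ω : Ω, ω.1.2.2.1 < 3 * z + 1 ∧ ω.1.2.2.2 < r.factorial := by
      rintro ⟨_, e, rfl⟩
      exact ⟨(hp e).1, (hp e).2.1⟩
    let j : Ω → V × V × Fin (3 * z + 1) × Fin (r.factorial) := fun ω =>
      (ω.1.1, ω.1.2.1, ⟨_, (this ω).1⟩, ⟨_, (this ω).2⟩)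
    have hj : Function.Injective j := by
      rintro ⟨⟨u, v, a, b⟩, h⟩ ⟨⟨u', v', a', b'⟩, h'⟩ heq
      simp only [j, Prod.mk.injEq, Fin.mk.injEq] at heq
      obtain ⟨rfl, rfl, rfl, rfl⟩ := heq
      rfl
    simpa [Nat.card_prod] using Nat.card_le_card_of_injective j hj
  have hfin : Finite Ω := Set.finite_range cls
  obtain ⟨emb⟩ : Nonempty (Fin r × Ω ↪ Finset (Fin (z - 1))) := by
    have := Fintype.ofFinite Ω
    refine Function.Embedding.nonempty_of_card_le ?_
    rw [Fintype.card_prod, Fintype.card_fin, Fintype.card_finset, Fintype.card_fin,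
      ← Nat.card_eq_fintype_card]
    exact (Nat.mul_le_mul_left r hΩ).trans hcode
  let col : Finset (Fin (z - 1)) → Finset ℕ := fun s =>
    insert z (insert (2 * z) (s.image fun j : Fin (z - 1) => z + 1 + (j : ℕ)))
  have hcol : ∀ s (j : Fin (z - 1)), z + 1 + (j : ℕ) ∈ col s ↔ j ∈ s := by
    intro s j
    have := j.2
    simp only [col, Finset.mem_insert, Finset.mem_image]
    constructor
    · rintro (h | h | ⟨j', hj', h⟩)
      · omega
      · omega
      · obtain rfl : j' = j := Fin.ext (by omega)
        exact hj'
    · exact fun h => Or.inr (Or.inr ⟨j, h, rfl⟩)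
  have hcol' : Function.Injective col := by
    intro s s' h
    ext j
    rw [← hcol s, h, hcol s']
  let code : ℕ → Ω → Finset ℕ := fun i ω =>
    col (if h : i < r then emb (⟨i, h⟩, ω) else ∅)
  refine ⟨Ω, ⟨r, z, hr, hz, mark, fun ω => ω.1.1, fun ω => ω.1.2.1, fun _ => rfl, fun _ => rfl,
    fun ω => ω.1.2.2.1, ?_, fun e => (Ψ (mark e) ⟨e, rfl⟩).1, ?_, ?_, ?_, code, ?_, ?_, ?_, ?_⟩,
    rfl, rfl⟩
  · rintro ⟨_, e, rfl⟩
    exact (hp e).1.le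
  · exact fun e => (Ψ (mark e) ⟨e, rfl⟩).2
  · intro e e' h h'
    rw [hΨ e _ h] at h'
    exact congrArg Subtype.val ((Ψ (mark e')).injective (Subtype.ext h'))
  · intro ω π hπ
    obtain ⟨⟨e, he⟩, h⟩ := (Ψ ω).surjective ⟨π, hπ⟩
    exact ⟨e, he, by rw [hΨ e ω he, h]⟩
  · intro i ω b hb
    simp only [code, col, Finset.mem_insert, Finset.mem_image] at hb
    rw [Finset.mem_Icc]
    rcases hb with rfl | rfl | ⟨j, -, rfl⟩
    · omega
    · omega
    · have := j.2
      omega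
  · exact fun i ω => Finset.mem_insert_self _ _
  · exact fun i ω => Finset.mem_insert_of_mem (Finset.mem_insert_self _ _)
  · intro i hi i' hi' ω ω' h
    have h := hcol' h
    rw [dif_pos hi, dif_pos hi'] at h
    have h := emb.injective h
    simpa using h

/-! ### Shifts of finite type as path spaces -/

section Presentation

variable {A : Type u} [TopologicalSpace A]

theorem IsOfFiniteType.exists_window [Inhabited A] {X : Subshift A ℤ} (hX : IsOfFiniteType X) :
    ∃ (n : ℕ) (L : Set (Fin n → A)), ∀ x, x ∈ X.carrier ↔
      ∀ k : ℤ, (fun j : Fin n => x (k + (j : ℕ))) ∈ L := by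
  obtain ⟨F, hF, hXF⟩ := hX
  obtain ⟨w, hw⟩ : ∃ w : ℕ, ∀ p ∈ F, ∀ h ∈ p.support, h.natAbs ≤ w := by
    have hfin : (⋃ p ∈ F, (p.support : Set ℤ)).Finite :=
      hF.biUnion fun p _ => p.support.finite_toSet
    obtain ⟨w, hw⟩ := (hfin.image Int.natAbs).bddAbove
    exact ⟨w, fun p hp h hh => hw ⟨h, Set.mem_biUnion hp hh, rfl⟩⟩
  -- A pattern placed at the centre `w` of the window lies inside it, so whether it occurs does not
  -- depend on the extension `y`.
  refine ⟨2 * w + 1, {u | ∀ y : ℤ → A, (∀ j : Fin (2 * w + 1), y (j : ℕ) = u j) →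
    ∀ p ∈ F, ¬ p.occursInAt y w}, fun x => ?_⟩
  rw [hXF]
  constructor
  · intro hx k y hy p hp hocc
    refine hx p hp (k + w) fun h hh => ?_
    have := hw p hp h hh
    rw [← hocc h hh]
    have h2 := hy ⟨(w + h).toNat, by omega⟩
    simp only at h2
    rw [Int.toNat_of_nonneg (by omega)] at h2
    rw [h2, add_assoc]
  · intro hx p hp g hocc
    refine hx (g - w) (shift (g - w) x) (fun j => rfl) p hp fun h hh => ?_
    rw [← hocc h hh, shift_apply]
    congr 1
    ring

/-- Edges are the allowed words of length m + n, and consecutive ones overlap in a vertex, a word of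
length n. One step along a path is m steps of the shift, and every window of length n lies inside
some edge. As n ≤ m, an overlap reaches only into the next edge. -/
theorem exists_path_presentation [DiscreteTopology A] [Finite A] (X : Subshift A ℤ)
    {n m : ℕ} (hm : 0 < m) (hnm : n ≤ m) (L : Set (Fin n → A))
    (hL : ∀ x, x ∈ X.carrier ↔ ∀ k : ℤ, (fun j : Fin n => x (k + (j : ℕ))) ∈ L) :
    ∃ (E V : Type u) (src tgt : E → V) (g : X.carrier → ℤ → E), Finite E ∧ Finite V ∧
      Nat.card E ≤ Nat.card A ^ (m + n) ∧ Nat.card V = Nat.card A ^ n ∧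
      (∀ k, IsLocallyConstant fun y => g y k) ∧ Function.Injective g ∧
      (∀ e, IsPath src tgt e ↔ ∃ y, g y = e) ∧
      ∀ y y' : X.carrier, y'.1 = shift (m : ℤ) y.1 → ∀ k, g y' k = g y (k + 1) := by
  let E := {w : Fin (m + n) → A //
    ∀ i : Fin (m + 1), (fun j : Fin n => w ⟨i + j, by omega⟩) ∈ L}
  let V := Fin n → A
  let src : E → V := fun w j => w.1 ⟨j, by omega⟩
  let tgt : E → V := fun w j => w.1 ⟨m + j, by omega⟩
  let g : X.carrier → ℤ → E := fun y k => ⟨fun j => y.1 (m * k + (j : ℕ)), fun i => by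
    have := (hL y.1).1 y.2 (m * k + (i : ℕ))
    simp only [Nat.cast_add, ← add_assoc]
    exact this⟩
  have hg : ∀ y k (j : Fin (m + n)), (g y k).1 j = y.1 (m * k + (j : ℕ)) := fun _ _ _ => rfl
  refine ⟨E, V, src, tgt, g, inferInstance, inferInstance, ?_, ?_, fun k => ?_, ?_, fun e => ?_, ?_⟩
  · refine (Nat.card_le_card_of_injective (Subtype.val : E → _) Subtype.val_injective).trans ?_
    rw [Nat.card_fun, Nat.card_fin]
  · rw [Nat.card_fun, Nat.card_fin]
  · rw [IsLocallyConstant.iff_eventually_eq]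
    intro y
    have : ∀ᶠ y' in nhds y, ∀ j : Fin (m + n),
        y'.1 (m * k + (j : ℕ)) = y.1 (m * k + (j : ℕ)) := by
      rw [Filter.eventually_all]
      intro j
      have hc : Continuous fun y' : X.carrier => y'.1 (m * k + (j : ℕ)) :=
        (continuous_apply _).comp continuous_subtype_val
      exact (IsLocallyConstant.iff_eventually_eq _).1
        ((IsLocallyConstant.iff_continuous _).2 hc) y
    filter_upwards [this] with y' hy'
    exact Subtype.ext (funext hy')
  · intro y y' h
    refine Subtype.ext (funext fun x => ?_)
    obtain ⟨k, w, hw, rfl⟩ := exists_eq_mul_add hm x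
    rw [← hg y k ⟨w, by omega⟩, h, hg]
  · constructor
    · intro he
      let y : ℤ → A := fun x => (e (x / m)).1 ⟨(x % m).toNat, by
        have := Int.emod_lt_of_pos x (show (0 : ℤ) < m by omega)
        omega⟩
      have hy0 : ∀ k (j : ℕ) (hj : j < m), y (m * k + j) = (e k).1 ⟨j, by omega⟩ := by
        intro k j hj
        have h1 : ((m : ℤ) * k + j) / m = k := by
          rw [add_comm, Int.add_mul_ediv_left _ _ (by omega),
            Int.ediv_eq_zero_of_lt (by omega) (by omega), zero_add]
        have h2 : ((m : ℤ) * k + j) % m = j := by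
          rw [add_comm, Int.add_mul_emod_self_left, Int.emod_eq_of_lt (by omega) (by omega)]
        simp only [y, h1, h2, Int.toNat_natCast]
      have hy : ∀ k (j : ℕ) (hj : j < m + n), y (m * k + j) = (e k).1 ⟨j, hj⟩ := by
        intro k j hj
        by_cases hjm : j < m
        · exact hy0 k j hjm
        · obtain ⟨j, rfl⟩ : ∃ i, j = m + i := ⟨j - m, by omega⟩
          have h1 := hy0 (k + 1) j (by omega)
          have h2 := congrFun (he k) ⟨j, by omega⟩
          rw [show (m : ℤ) * k + (m + j : ℕ) = m * (k + 1) + j by push_cast; ring, h1]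
          exact h2.symm
      have hyX : y ∈ X.carrier := by
        rw [hL]
        intro x
        obtain ⟨k, w, hw, rfl⟩ := exists_eq_mul_add hm x
        have h1 := (e k).2 ⟨w, by omega⟩
        convert h1 using 2 with j
        rw [add_assoc, ← Nat.cast_add]
        exact hy k _ _
      exact ⟨⟨y, hyX⟩, funext fun k => Subtype.ext (funext fun j => hy k j j.2)⟩
    · rintro ⟨y, rfl⟩ k
      funext j
      simp only [src, tgt, hg]
      refine congrArg y.1 ?_
      push_cast; ring
  · intro y y' h k
    refine Subtype.ext (funext fun j => ?_)
    change y'.1 _ = y.1 (m * (k + 1) + (j : ℕ))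
    rw [h, shift_apply]
    refine congrArg y.1 ?_
    ring

end Presentation

/-! ### Choice of parameters and conclusion -/

/-- The exponent on the left is twice the period, which bounds m + n. Once K^(12r) < r!, the first
inequality holds for every z; then z is taken so large that 2^(z-1) beats a quantity linear in z. -/
theorem exists_parameters (K n : ℕ) :
    ∃ r z : ℕ, 0 < r ∧ 0 < z ∧ n ≤ z ∧
      K ^ (2 * (6 * (3 * z + 1) * r)) < r.factorial ^ (3 * z + 1) ∧
      r * (K ^ n * (K ^ n * ((3 * z + 1) * r.factorial))) ≤ 2 ^ (z - 1) := by
  obtain ⟨r, h, hr⟩ := ((Nat.eventually_pow_lt_factorial_sub (K ^ 12) 0).and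
    (Filter.eventually_gt_atTop 0)).exists
  have hr1 : (K ^ 12) ^ r < r.factorial := by simpa using h
  set D := r * K ^ n * K ^ n * r.factorial with hD
  set s := 10 * D + n + 1 with hs
  refine ⟨r, 2 * s + 1, by omega, by omega, by omega, ?_, ?_⟩
  · calc K ^ (2 * (6 * (3 * (2 * s + 1) + 1) * r)) = ((K ^ 12) ^ r) ^ (3 * (2 * s + 1) + 1) := by
          rw [← pow_mul, ← pow_mul]; congr 1; ring
      _ < _ := Nat.pow_lt_pow_left hr1 (by omega)
  · have h2 : s < 2 ^ s := Nat.lt_two_pow_self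
    calc r * (K ^ n * (K ^ n * ((3 * (2 * s + 1) + 1) * r.factorial)))
        = D * (6 * s + 4) := by rw [hD]; ring
      _ ≤ D * (10 * s) := Nat.mul_le_mul_left _ (by omega)
      _ = (10 * D) * s := by ring
      _ ≤ s * s := Nat.mul_le_mul_right _ (by omega)
      _ ≤ 2 ^ s * 2 ^ s := Nat.mul_le_mul h2.le h2.le
      _ = 2 ^ (2 * s + 1 - 1) := by rw [← pow_add]; congr 1; omega

/-- No tiling of the integers uses translates of `{0, 1, 3}` only. -/
theorem tilingSpace_eq_empty : tilingSpace {({0, 1, 3} : Finset ℤ)} = ∅ := by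
  rw [Set.eq_empty_iff_forall_notMem]
  rintro x ⟨S, hS, -⟩
  have hmem : ∀ (q : ℤ × Color {({0, 1, 3} : Finset ℤ)}) (i : ℤ),
      i ∈ tile q ↔ i = q.1 ∨ i = q.1 + 1 ∨ i = q.1 + 3 := by
    intro q i
    rw [mem_tile, Finset.mem_singleton.1 q.2.2]
    simp only [Finset.mem_insert, Finset.mem_singleton]
    omega
  obtain ⟨q, hq, -⟩ := hS.exists_mem 0
  obtain ⟨q', hq', h⟩ := hS.exists_mem (q.1 + 2)
  have hmem' : ∀ i, i ∈ tile q → i ∈ tile q' → False := by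
    intro i hi hi'
    obtain rfl := hS.eq_of_mem hq hq' hi hi'
    rw [hmem] at h
    omega
  simp only [hmem] at h hmem'
  have h1 := hmem' (q.1 + 1)
  have h2 := hmem' (q.1 + 3)
  have h3 := hmem' q.1
  -- The gap at `q.1 + 2` would need a tile starting at `q.1 + 2`, `q.1 + 1` or `q.1 - 1`, which
  -- overlaps `q` at `q.1 + 3`, `q.1 + 1` or `q.1`.
  rcases h with h | h | h
  · exact h2 (by omega) (by omega)
  · exact h1 (by omega) (by omega)
  · exact h3 (by omega) (by omega)

open TileCoding in
theorem mainTheorem1 {A : Type*} [Finite A] [Inhabited A] [TopologicalSpace A]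
    [DiscreteTopology A] (X : Subshift A ℤ) (hX : IsOfFiniteType X) :
    ∃ m : ℕ, 1 ≤ m ∧ ∃ P : Finset (Finset ℤ), IsPrototileCollection P ∧
      ∃ T : ZMod m → Set (ℤ → Color P),
        tilingSpace P = ⋃ i, T i ∧
        (∀ i, IsClosed (T i)) ∧
        (∀ i, shift (1 : ℤ) '' T i = T (i + 1)) ∧
        ∀ i, ∃ hi : Set.MapsTo (shift (1 : ℤ))^[m] (T i) (T i),
          TopologicallyConjugate ((X.mapsTo 1).iterate m).restrict hi.restrict := by
  rcases isEmpty_or_nonempty X.carrier with hemp | ⟨⟨y₀⟩⟩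
  · refine ⟨1, le_rfl, {{0, 1, 3}}, ⟨Finset.singleton_nonempty _, ?_⟩, fun _ => ∅, ?_, ?_, ?_, ?_⟩
    · intro p hp
      rw [Finset.mem_singleton.1 hp]
      constructor
      · simp
      · intro i hi
        simp only [Finset.coe_insert, Finset.coe_singleton, Set.mem_insert_iff,
          Set.mem_singleton_iff] at hi
        omega
    · rw [tilingSpace_eq_empty]; simp
    · simp
    · simp
    · exact fun i => ⟨Set.mapsTo_empty _ _, Homeomorph.empty, fun y => isEmptyElim y⟩
  · obtain ⟨n, L, hL⟩ := hX.exists_window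
    obtain ⟨r, z, hr, hz, hnz, hE, hcode⟩ := exists_parameters (Nat.card A) n
    have hm : z ≤ 6 * (3 * z + 1) * r := by nlinarith
    obtain ⟨E, V, src, tgt, g, _, _, hEc, hVc, hloc, hinj, hrange, hshift⟩ :=
      exists_path_presentation X (n := n) (m := 6 * (3 * z + 1) * r) (by omega) (by omega) L hL
    obtain ⟨Ω, C, rfl, rfl⟩ : ∃ (Ω : Type _) (C : TileCoding src tgt Ω), C.r = r ∧ C.z = z := by
      refine exists_tileCoding src tgt hr hz (lt_of_le_of_lt (hEc.trans ?_) hE) (by rwa [hVc])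
      exact Nat.pow_le_pow_right Nat.card_pos (by omega)
    have : CompactSpace X.carrier := isCompact_iff_compactSpace.1 X.isClosed.isCompact
    -- A point of the shift yields an admissible tile, so that the collection is nonempty.
    have hv := valid_param (C := C) ((hrange _).2 ⟨y₀, rfl⟩) 0 ⟨0, C.r_pos⟩
    refine ⟨C.period, C.period_pos, C.prototiles, ⟨⟨_, hv.shape_mem⟩, fun p hp => ?_⟩,
      exists_conjugacy _ g hloc hinj hrange fun y k => hshift y _ ?_ k⟩
    · obtain ⟨τ, hτ, rfl⟩ := mem_prototiles.1 hp
      exact hτ.isLeast_shape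
    · exact iterate_shift_one C.period y.1
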